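/- \textbf{Setting.} Types (abilities) $t$ lie in $[\underline t,\overline t]$, $\underline t<\overline t$, and have a continuous, strictly positive density $f$; expectations are with respect to it. An allocation is a pair $(l,y)$ of a labor income $l$ and an ordeal $y$; the set of allocations $\mathcal X\subset\mathbb R_+^2$ is compact, every $(l,y)\in\mathcal X$ has $l\in[\underline l,\overline l]$ or $l=0$, where $0\le\underline l\le\overline l$, and $\mathcal X$ contains the no-ordeal menu $$M=\{(l,0): l\in[\underline l,\overline l]\}\cup\{(0,0)\},$$ where $(0,0)$ is the outside option (if $\underline l=0$, then $M=\{(l,0)\}_{l\in[\underline l,\overline l]}$). Type $t$ with allocation $(l,y)$ and tax $T$ has payoff $l-\psi(l,y,t)-T$. For $(l,y)\in\mathcal X$ the disutility $\psi(l,y,t)$ is differentiable in $t$, with $\psi_t$ continuous on $\mathcal X\times[\underline t,\overline t]$, is non-increasing in $t$, strictly decreasing if $l>0$, and satisfies $\psi(l,0,t)\le\psi(l,y,t)$. Moreover $\psi(0,0,t)=0$, and on $[\underline l,\overline l]\times[\underline t,\overline t]$ the function $\psi(l,0,t)$ is strictly submodular in $(l,t)$ and continuous in $l$. The welfare weight $\lambda\ge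 0$ is continuous and non-increasing on $[\underline t,\overline t]$. A mechanism is a measurable map $t\mapsto(l(t),y(t),T(t))\in\mathcal X\times\mathbb R$ with $T$ integrable that is incentive compatible (IC): $l(t)-\psi(l(t),y(t),t)-T(t)\ge l(s)-\psi(l(s),y(s),t)-T(s)$ for all $t,s$. The \emph{government's problem}, with public expenditure $E\ge0$, is to maximize $$\mathbb E\big[\lambda(t)\,(l(t)-\psi(l(t),y(t),t)-T(t))\big]$$ over mechanisms with $\mathbb E[T(t)]\ge E$. The \emph{normalized screening problem} with weight $\tilde\lambda=\lambda/\kappa$, where $\kappa>0$ and $\mathbb E[\tilde\lambda(t)]=1$, is to maximize $$\mathbb E\big[\tilde\lambda(t)\,(l(t)-\psi(l(t),y(t),t)-T(t))\big]+\mathbb E[T(t)]$$ over mechanisms that are individually rational, i.e. $l(t)-\psi(l(t),y(t),t)-T(t)\ge0$ for all $t$. A set of allocations is an \emph{optimal menu} of a problem if the problem has an optimal mechanism with $(l(t),y(t))$ in that set for all $t$. \textbf{Proposition.} Suppose that one of the following holds. (a) For every $(l,y)\in\mathcal X$, $\psi(l,y,t)-\psi(l,0,t)$ is non-increasing in $t$.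 (b) $l-\psi(l,0,t)$ is log-supermodular in $(l,t)\in[\underline l,\overline l]\times[\underline t,\overline t]$, and for every $(l,y)\in\mathcal X$ one has $l-\psi(l,y,t)\ge0$ for all $t$ and $$\frac{l-\psi(l,y,t)}{l-\psi(l,0,t)}\quad\text{is non-decreasing in } t$$ (where the denominator vanishes, so does the numerator, and the ratio is read as $0$). Then the no-ordeal menu $M$ is an optimal menu, i.e. no costly screening is optimal, both in the government's problem, for every $E\ge0$, and in the normalized screening problem, for every $\kappa>0$ with $\mathbb E[\lambda(t)/\kappa]=1$. -/

import Mathlib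

open Set MeasureTheory

/-- The law of the type: density `f` on the type space `[tlo, thi]`. -/
noncomputable def typeLaw (tlo thi : ℝ) (f : ℝ → ℝ) : Measure ℝ :=
  (volume.restrict (Icc tlo thi)).withDensity (fun t => ENNReal.ofReal (f t))

/-- The gross payoff `l - ψ(l, y, t)` of type `t` at the allocation `x = (l, y)`
(labor income `l`, ordeal `y`), before taxes. -/
def grossPayoff (ψ : ℝ → ℝ → ℝ → ℝ) (x : ℝ × ℝ) (t : ℝ) : ℝ :=
  x.1 - ψ x.1 x.2 t

/-- A direct mechanism `t ↦ (x t, T t)`, where `x t = (l t, y t)`, is a measurable map with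
allocations in `X` that is incentive compatible. Only its values on the type space matter. -/
structure IsICMechanism (tlo thi : ℝ) (X : Set (ℝ × ℝ)) (ψ : ℝ → ℝ → ℝ → ℝ)
    (x : ℝ → ℝ × ℝ) (T : ℝ → ℝ) : Prop where
  measurable_alloc : Measurable x
  measurable_tax : Measurable T
  mem : ∀ t ∈ Icc tlo thi, x t ∈ X
  ic : ∀ t ∈ Icc tlo thi, ∀ s ∈ Icc tlo thi,
    grossPayoff ψ (x s) t - T s ≤ grossPayoff ψ (x t) t - T t

/-- Individual rationality with respect to an outside option of payoff `0`. -/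
def IsIR (tlo thi : ℝ) (ψ : ℝ → ℝ → ℝ → ℝ) (x : ℝ → ℝ × ℝ) (T : ℝ → ℝ) : Prop :=
  ∀ t ∈ Icc tlo thi, 0 ≤ grossPayoff ψ (x t) t - T t

/-- `E[w(t) (l(t) - ψ(l(t), y(t), t) - T(t))]`. -/
noncomputable def weightedWelfare (μ : Measure ℝ) (w : ℝ → ℝ) (ψ : ℝ → ℝ → ℝ → ℝ)
    (x : ℝ → ℝ × ℝ) (T : ℝ → ℝ) : ℝ :=
  ∫ t, w t * (grossPayoff ψ (x t) t - T t) ∂μ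

/-- Feasibility in the government's problem: incentive compatibility and the budget constraint
`E[T(t)] ≥ G`; the tax revenue has to be a genuine expectation. -/
structure IsBudgetFeasible (tlo thi : ℝ) (μ : Measure ℝ) (X : Set (ℝ × ℝ))
    (ψ : ℝ → ℝ → ℝ → ℝ) (G : ℝ) (x : ℝ → ℝ × ℝ) (T : ℝ → ℝ) : Prop where
  isIC : IsICMechanism tlo thi X ψ x T
  integrable_tax : Integrable T μ
  budget : G ≤ ∫ t, T t ∂μ

/-- `M` is an optimal menu in the government's problem of maximizing weighted welfare over
incentive compatible mechanisms that satisfy the budget constraint: some optimal mechanism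
assigns to every type an allocation in `M`. -/
def IsOptimalTaxMenu (tlo thi : ℝ) (μ : Measure ℝ) (X : Set (ℝ × ℝ)) (ψ : ℝ → ℝ → ℝ → ℝ)
    (w : ℝ → ℝ) (G : ℝ) (M : Set (ℝ × ℝ)) : Prop :=
  ∃ (x : ℝ → ℝ × ℝ) (T : ℝ → ℝ),
    IsBudgetFeasible tlo thi μ X ψ G x T ∧
    (∀ t ∈ Icc tlo thi, x t ∈ M) ∧
    ∀ (x' : ℝ → ℝ × ℝ) (T' : ℝ → ℝ), IsBudgetFeasible tlo thi μ X ψ G x' T' →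
      weightedWelfare μ w ψ x' T' ≤ weightedWelfare μ w ψ x T

/-- Feasibility in the screening problem: incentive compatibility and individual rationality,
with transfers that have an expectation. -/
structure IsScreeningFeasible (tlo thi : ℝ) (μ : Measure ℝ) (X : Set (ℝ × ℝ))
    (ψ : ℝ → ℝ → ℝ → ℝ) (x : ℝ → ℝ × ℝ) (T : ℝ → ℝ) : Prop where
  isIC : IsICMechanism tlo thi X ψ x T
  isIR : IsIR tlo thi ψ x T
  integrable_tax : Integrable T μ

/-- `M` is an optimal menu in the screening problem of maximizing weighted welfare plus revenue
over incentive compatible and individually rational mechanisms. -/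
def IsOptimalScreeningMenu (tlo thi : ℝ) (μ : Measure ℝ) (X : Set (ℝ × ℝ))
    (ψ : ℝ → ℝ → ℝ → ℝ) (w : ℝ → ℝ) (M : Set (ℝ × ℝ)) : Prop :=
  ∃ (x : ℝ → ℝ × ℝ) (T : ℝ → ℝ),
    IsScreeningFeasible tlo thi μ X ψ x T ∧
    (∀ t ∈ Icc tlo thi, x t ∈ M) ∧
    ∀ (x' : ℝ → ℝ × ℝ) (T' : ℝ → ℝ), IsScreeningFeasible tlo thi μ X ψ x' T' →
      weightedWelfare μ w ψ x' T' + ∫ t, T' t ∂μ ≤ weightedWelfare μ w ψ x T + ∫ t, T t ∂μ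

/-- Strict submodularity of `g(l, t)` on `A × B`. -/
def StrictSubmodularOn (g : ℝ → ℝ → ℝ) (A B : Set ℝ) : Prop :=
  ∀ l ∈ A, ∀ l' ∈ A, ∀ t ∈ B, ∀ t' ∈ B, l < l' → t < t' →
    g l t + g l' t' < g l t' + g l' t

/-- Log-supermodularity of a nonnegative function `g(l, t)` on `A × B`, in product form. -/
def LogSupermodularOn (g : ℝ → ℝ → ℝ) (A B : Set ℝ) : Prop :=
  ∀ l ∈ A, ∀ l' ∈ A, ∀ t ∈ B, ∀ t' ∈ B, l < l' → t < t' →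
    g l t' * g l' t ≤ g l t * g l' t'

/-- The allocations without costly screening, `(l, 0)` for `l ∈ [llo, lhi]`, together with the
outside option `(0, 0)`. -/
def noOrdealMenu (llo lhi : ℝ) : Set (ℝ × ℝ) :=
  {x | (x.1 ∈ Icc llo lhi ∨ x.1 = 0) ∧ x.2 = 0}

/-- The primitives of the taxation environment with ordeals. -/
structure IsOrdealEnvironment (tlo thi llo lhi : ℝ) (f lam : ℝ → ℝ) (X : Set (ℝ × ℝ))
    (ψ : ℝ → ℝ → ℝ → ℝ) : Prop where
  -- types
  type_lt : tlo < thi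
  density_continuous : ContinuousOn f (Icc tlo thi)
  density_pos : ∀ t ∈ Icc tlo thi, 0 < f t
  density_integral : ∫ t in Icc tlo thi, f t = 1
  -- redistributive welfare weights
  weight_continuous : ContinuousOn lam (Icc tlo thi)
  weight_nonneg : ∀ t ∈ Icc tlo thi, 0 ≤ lam t
  weight_antitone : AntitoneOn lam (Icc tlo thi)
  -- allocations
  income_nonneg : 0 ≤ llo
  income_le : llo ≤ lhi
  compact : IsCompact X
  income_mem : ∀ x ∈ X, x.1 ∈ Icc llo lhi ∨ x.1 = 0
  ordeal_nonneg : ∀ x ∈ X, 0 ≤ x.2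
  noOrdeal_subset : noOrdealMenu llo lhi ⊆ X
  -- disutility: smooth and decreasing in ability (strictly so at positive incomes)
  disutility_differentiable : ∀ x ∈ X, DifferentiableOn ℝ (ψ x.1 x.2) (Icc tlo thi)
  disutility_deriv_continuous :
    ContinuousOn (fun q : (ℝ × ℝ) × ℝ => derivWithin (ψ q.1.1 q.1.2) (Icc tlo thi) q.2)
      (X ×ˢ Icc tlo thi)
  disutility_antitone : ∀ x ∈ X, AntitoneOn (ψ x.1 x.2) (Icc tlo thi)
  disutility_strictAnti : ∀ x ∈ X, 0 < x.1 → StrictAntiOn (ψ x.1 x.2) (Icc tlo thi)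
  -- ordeals are costly; properties of the disutility without ordeal
  ordeal_costly : ∀ x ∈ X, ∀ t ∈ Icc tlo thi, ψ x.1 0 t ≤ ψ x.1 x.2 t
  strictSubmodular : StrictSubmodularOn (fun l t => ψ l 0 t) (Icc llo lhi) (Icc tlo thi)
  continuous_income : ∀ t ∈ Icc tlo thi, ContinuousOn (fun l => ψ l 0 t) (Icc llo lhi)
  disutility_zero : ∀ t ∈ Icc tlo thi, ψ 0 0 t = 0

/-- The extra disutility of every ordeal is non-increasing in ability. -/
def OrdealCostAntitone (tlo thi : ℝ) (X : Set (ℝ × ℝ)) (ψ : ℝ → ℝ → ℝ → ℝ) : Prop :=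
  ∀ x ∈ X, AntitoneOn (fun t => ψ x.1 x.2 t - ψ x.1 0 t) (Icc tlo thi)

/-- `l - ψ(l, 0, t)` is log-supermodular, and for all `(l, y) ∈ X` one has `l - ψ(l, y, t) ≥ 0`
and the ratio `(l - ψ(l, y, t)) / (l - ψ(l, 0, t))` is non-decreasing in `t`.
Where the denominator vanishes so does the numerator, and the quotient is then read as `0`; for
`l > 0` this can only happen at the lowest type, and for `l = 0` the ratio is `0` throughout, so
that these points add no requirement. -/
def SurplusRatioCondition (tlo thi llo lhi : ℝ) (X : Set (ℝ × ℝ))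
    (ψ : ℝ → ℝ → ℝ → ℝ) : Prop :=
  LogSupermodularOn (fun l t => l - ψ l 0 t) (Icc llo lhi) (Icc tlo thi) ∧
  (∀ x ∈ X, ∀ t ∈ Icc tlo thi, 0 ≤ x.1 - ψ x.1 x.2 t) ∧
  ∀ x ∈ X, MonotoneOn (fun t => (x.1 - ψ x.1 x.2 t) / (x.1 - ψ x.1 0 t)) (Icc tlo thi)

/-! Welfare plus revenue equals expected surplus plus `E[(w - 1) U]`, where `U` is the indirect
utility and `w - 1` is non-increasing with mean zero. Of incentive compatibility, a competing
mechanism is only asked to keep the downward constraints: no type gains by mimicking a lower one.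
Under either hypothesis the allocation of each type can then be exchanged, at unchanged `U`, for a
no-ordeal one that is at least as efficient and whose payoff rises no faster towards higher types,
so the downward constraints survive (`exists_menu_replacement`). In case (a) the ordeal is simply
removed; in case (b) income is lowered as well, possibly by randomizing with the outside option.
These lotteries fill the gap between `0` and `llo` and turn the menu into a chain
(`IsSurplusChain`).

The exchanged rule need not be monotone. With finitely many types, a maximizer under the downward
constraints is monotone (`exists_monotone_of_downward`), and Chebyshev's inequality allows its
utilities to be replaced by information rents. Discretization and Helly's theorem carry this to the
continuum (`exists_monotone_ge_downward`), so every mechanism is bounded by the virtual surplus of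
an optimal monotone rule. That virtual surplus is an average over lottery draws with a common seed,
hence some draw does at least as well, and it is a monotone deterministic no-ordeal rule. Such a
rule, with its rents as utilities, is fully incentive compatible. The government's problem reduces
to this by a lump-sum tax. -/

/-! ### Finitely many types: monotonicity from the downward constraints. -/

/-- A sequence that is not monotone below `n` has a first descent. -/
lemma exists_first_descent {n : ℕ} {z : ℕ → ℝ}
    (h : ¬ ∀ i j, i ≤ j → j < n → z i ≤ z j) :
    ∃ i, i + 1 < n ∧ z (i + 1) < z i ∧ ∀ k ≤ i, z k ≤ z i := by
  classical
  have hex : ∃ i, i + 1 < n ∧ z (i + 1) < z i := by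
    by_contra! hcon
    apply h
    intro i j hij
    induction j, hij using Nat.le_induction with
    | base => exact fun _ => le_rfl
    | succ j _ ih => exact fun hj => (ih (by omega)).trans (hcon j hj)
  obtain ⟨hn, hlt⟩ := Nat.find_spec hex
  refine ⟨Nat.find hex, hn, hlt, ?_⟩
  have key : ∀ m, m ≤ Nat.find hex → ∀ k ≤ m, z k ≤ z m := by
    intro m
    induction m with
    | zero => intro _ k hk; rw [Nat.le_zero.mp hk]
    | succ m ih =>
      intro hm k hk
      rcases Nat.lt_or_ge k (m + 1) with hk' | hk'
      · have := Nat.find_min hex (m := m) (by omega)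
        have h2 : z m ≤ z (m + 1) := by
          by_contra! h3
          exact this ⟨by omega, h3⟩
        exact (ih (by omega) k (by omega)).trans h2
      · rw [le_antisymm hk hk']
  exact key _ le_rfl

lemma sum_sub_sum_eq_of_eq_off {n k : ℕ} (hk : k < n) {F F' : ℕ → ℝ}
    (h : ∀ i, i ≠ k → F' i = F i) :
    ∑ i ∈ Finset.range n, F' i - ∑ i ∈ Finset.range n, F i = F' k - F k := by
  rw [← Finset.sum_sub_distrib]
  refine Finset.sum_eq_single k (fun i _ hi => by rw [h i hi, sub_self]) (fun h' => ?_)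
  exact absurd (Finset.mem_range.mpr hk) h'

/-- With finitely many types, every allocation rule that satisfies the downward incentive
constraints is dominated by a monotone one. -/
lemma exists_monotone_of_downward {n : ℕ} {L B₀ B₁ : ℝ} {G : ℝ → ℝ → ℝ} {t p c : ℕ → ℝ}
    (hG : ∀ s, Continuous fun z => G z s)
    (hp : ∀ i < n, 0 < p i) (hc : ∀ i j, i ≤ j → j < n → c j ≤ c i)
    (hmono : ∀ z ∈ Icc 0 L, ∀ i j, i < j → j < n → G z (t i) ≤ G z (t j))
    (hsup : ∀ z ∈ Icc 0 L, ∀ z' ∈ Icc 0 L, z < z' → ∀ i j, i < j → j < n →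
      G z (t j) - G z (t i) < G z' (t j) - G z' (t i))
    {z U : ℕ → ℝ} (hz : ∀ i, z i ∈ Icc 0 L) (hU : ∀ i, U i ∈ Icc B₀ B₁)
    (hIC : ∀ i j, i < j → j < n → G (z i) (t j) - G (z i) (t i) ≤ U j - U i) :
    ∃ z' U' : ℕ → ℝ, (∀ i, z' i ∈ Icc 0 L) ∧ (∀ i j, i ≤ j → j < n → z' i ≤ z' j) ∧
      (∀ i j, i < j → j < n → G (z' i) (t j) - G (z' i) (t i) ≤ U' j - U' i) ∧
      ∑ i ∈ Finset.range n, p i * (G (z i) (t i) + c i * U i) ≤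
        ∑ i ∈ Finset.range n, p i * (G (z' i) (t i) + c i * U' i) := by
  -- Allocations and utilities range over whole sequences, so compactness is Tychonoff's theorem;
  -- coordinates from `n` on enter neither the constraints nor the objective.
  set K : Set ((ℕ → ℝ) × (ℕ → ℝ)) :=
    (Set.univ.pi (fun _ => Icc 0 L) ×ˢ Set.univ.pi (fun _ => Icc B₀ B₁)) ∩
      {q | ∀ i j, i < j → j < n → G (q.1 i) (t j) - G (q.1 i) (t i) ≤ q.2 j - q.2 i} with hK
  have memK : ∀ z U : ℕ → ℝ, (z, U) ∈ K ↔ ((∀ i, z i ∈ Icc 0 L) ∧ ∀ i, U i ∈ Icc B₀ B₁) ∧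
      ∀ i j, i < j → j < n → G (z i) (t j) - G (z i) (t i) ≤ U j - U i := by
    intro z U
    simp only [hK, mem_inter_iff, mem_prod, mem_univ_pi, mem_ofPred_eq]
  have hGc : ∀ i s, Continuous fun q : (ℕ → ℝ) × (ℕ → ℝ) => G (q.1 i) s := fun i s =>
    (hG s).comp ((continuous_apply i).comp continuous_fst)
  have hUc : ∀ i, Continuous fun q : (ℕ → ℝ) × (ℕ → ℝ) => q.2 i := fun i =>
    (continuous_apply i).comp continuous_snd
  have hcomp : IsCompact K := by
    refine IsCompact.inter_right ?_ ?_
    · exact (isCompact_univ_pi fun _ => isCompact_Icc).prod (isCompact_univ_pi fun _ => isCompact_Icc)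
    · simp only [ofPred_forall]
      refine isClosed_iInter fun i => isClosed_iInter fun j => isClosed_iInter fun _ =>
        isClosed_iInter fun _ => ?_
      exact isClosed_le ((hGc i _).sub (hGc i _)) ((hUc j).sub (hUc i))
  obtain ⟨⟨x, V⟩, hxK, hmax⟩ := hcomp.exists_isMaxOn ⟨(z, U), (memK z U).2 ⟨⟨hz, hU⟩, hIC⟩⟩
    (f := fun q => ∑ i ∈ Finset.range n, p i * (G (q.1 i) (t i) + c i * q.2 i))
    (continuous_finsetSum _ fun i _ => continuous_const.mul
      ((hGc i _).add (continuous_const.mul (hUc i)))).continuousOn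
  obtain ⟨⟨hx, hV⟩, hxV⟩ := (memK x V).1 hxK
  refine ⟨x, V, hx, ?_, hxV, hmax ((memK z U).2 ⟨⟨hz, hU⟩, hIC⟩)⟩
  by_contra hnot
  -- The descent must be the first one: when type `i + 1` is moved to `x i`, the constraints from
  -- types `j < i` survive by supermodularity because `x j ≤ x i`.
  obtain ⟨i, hin, hdesc, hprev⟩ := exists_first_descent hnot
  -- changing the maximizer at a single type is not profitable
  have key : ∀ k < n, ∀ y u : ℝ, y ∈ Icc 0 L → u ∈ Icc B₀ B₁ →
      (∀ j, j < k → G (x j) (t k) - G (x j) (t j) ≤ u - V j) →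
      (∀ j, k < j → j < n → G y (t j) - G y (t k) ≤ V j - u) →
      G y (t k) + c k * u ≤ G (x k) (t k) + c k * V k := by
    intro k hk y u hy hu h1 h2
    have hmem : (Function.update x k y, Function.update V k u) ∈ K := by
      refine (memK _ _).2 ⟨⟨fun j => ?_, fun j => ?_⟩, fun i' j hij hj => ?_⟩
      · rcases eq_or_ne j k with rfl | hjk
        · simpa using hy
        · simpa [hjk] using hx j
      · rcases eq_or_ne j k with rfl | hjk
        · simpa using hu
        · simpa [hjk] using hV j
      · rcases eq_or_ne i' k with rfl | hik
        · simpa [hij.ne'] using h2 j hij hj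
        · rcases eq_or_ne j k with rfl | hjk
          · simpa [hik] using h1 i' hij
          · simpa [hik, hjk] using hxV i' j hij hj
    have h3 := hmax hmem
    simp only [mem_ofPred_eq] at h3
    have h4 := sum_sub_sum_eq_of_eq_off hk
      (F := fun i => p i * (G (x i) (t i) + c i * V i))
      (F' := fun i => p i * (G (Function.update x k y i) (t i) + c i * Function.update V k u i))
      (fun j hj => by simp [hj])
    simp only [Function.update_self] at h4
    have h5 : p k * (G y (t k) + c k * u) ≤ p k * (G (x k) (t k) + c k * V k) := by linarith
    exact le_of_mul_le_mul_left h5 (hp k hk)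
  have hi : i < n := by omega
  have hsup' : ∀ k m, k < m → m < n → G (x (i + 1)) (t m) - G (x (i + 1)) (t k) <
      G (x i) (t m) - G (x i) (t k) := fun k m hkm hm => hsup _ (hx _) _ (hx _) hdesc k m hkm hm
  have hICi := hxV i (i + 1) (by omega) hin
  have hsi := hsup' i (i + 1) (by omega) hin
  -- lower the allocation of the lower type at constant utility
  have opt1 := key i hi (x (i + 1)) (V i) (hx _) (hV _) (fun j hj => hxV j i hj hi)
    (fun j hj hjn => (hsup' i j hj hjn).le.trans (hxV i j hj hjn))
  -- pool both types at the higher allocation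
  have opt2 := key (i + 1) hin (x i) (V i + (G (x i) (t (i + 1)) - G (x i) (t i))) (hx _)
    ⟨by linarith [(hV i).1, hmono _ (hx i) i (i + 1) (by omega) hin], by linarith [(hV (i + 1)).2]⟩
    (fun j hj => by
      rcases Nat.lt_or_ge j i with hji | hji
      · have h1 := hxV j i hji hi
        have h2 : G (x j) (t (i + 1)) - G (x j) (t i) ≤ G (x i) (t (i + 1)) - G (x i) (t i) := by
          rcases (hprev j hji.le).lt_or_eq with h | h
          · exact (hsup _ (hx _) _ (hx _) h i (i + 1) (by omega) hin).le
          · rw [h]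
        linarith
      · have : j = i := by omega
        subst this; linarith)
    (fun j hj hjn => by linarith [hxV i j (by omega) hjn])
  -- pool both types at the lower allocation
  have opt3 := key i hi (x (i + 1))
    (V (i + 1) - (G (x (i + 1)) (t (i + 1)) - G (x (i + 1)) (t i))) (hx _)
    ⟨by linarith [(hV i).1], by
      linarith [(hV (i + 1)).2, hmono _ (hx (i + 1)) i (i + 1) (by omega) hin]⟩
    (fun j hj => by linarith [hxV j i hj hi])
    (fun j hj hjn => by
      rcases Nat.lt_or_ge (i + 1) j with hji | hji
      · linarith [hxV (i + 1) j hji hjn]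
      · have : j = i + 1 := by omega
        subst this; linarith)
  have hcc := hc i (i + 1) (by omega) hin
  -- `σ` is the slack in the constraint between the two types. Pooling high bounds the efficiency
  -- gain of `x i` over `x (i + 1)` at the upper type by `c (i + 1) * σ`. Pooling low raises the
  -- lower type's utility by at least `σ`, so the same gain at the lower type is at least `c i * σ`,
  -- hence at least `c (i + 1) * σ`. Strict supermodularity makes the gain strictly larger at the
  -- upper type, a contradiction; `opt1` supplies the positivity of `c (i + 1)`.
  set σ := V (i + 1) - V i - (G (x i) (t (i + 1)) - G (x i) (t i)) with hσ
  have hσ0 : 0 ≤ σ := by linarith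
  have e2 : c (i + 1) * σ ≥ G (x i) (t (i + 1)) - G (x (i + 1)) (t (i + 1)) := by
    rw [hσ]; linarith
  have hcpos : 0 < c (i + 1) := by
    by_contra! h
    have := mul_nonneg_of_nonpos_of_nonpos h (neg_nonpos.mpr hσ0)
    linarith
  have e3 : c i * (V (i + 1) - (G (x (i + 1)) (t (i + 1)) - G (x (i + 1)) (t i)) - V i) ≤
      G (x i) (t i) - G (x (i + 1)) (t i) := by linarith
  have e4 : c i * σ ≤
      c i * (V (i + 1) - (G (x (i + 1)) (t (i + 1)) - G (x (i + 1)) (t i)) - V i) :=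
    mul_le_mul_of_nonneg_left (by linarith) (by linarith)
  have e5 : c (i + 1) * σ ≤ c i * σ := mul_le_mul_of_nonneg_right hcc hσ0
  linarith

/-- A weighted Chebyshev inequality. -/
lemma sum_mul_nonpos_of_antitone_of_monotone {n : ℕ} {p c E : ℕ → ℝ} (hp : ∀ i < n, 0 ≤ p i)
    (hc : ∀ i j, i ≤ j → j < n → c j ≤ c i) (hE : ∀ i j, i ≤ j → j < n → E i ≤ E j)
    (h0 : ∑ i ∈ Finset.range n, p i * c i = 0) :
    ∑ i ∈ Finset.range n, p i * (c i * E i) ≤ 0 := by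
  classical
  suffices h : ∃ e, ∀ i < n, c i * (E i - e) ≤ 0 by
    obtain ⟨e, he⟩ := h
    have h1 : ∑ i ∈ Finset.range n, p i * (c i * E i) =
        ∑ i ∈ Finset.range n, p i * (c i * (E i - e)) := by
      have : ∑ i ∈ Finset.range n, p i * (c i * (E i - e)) =
          ∑ i ∈ Finset.range n, p i * (c i * E i) - e * ∑ i ∈ Finset.range n, p i * c i := by
        rw [Finset.mul_sum, ← Finset.sum_sub_distrib]
        exact Finset.sum_congr rfl fun i _ => by ring
      rw [this, h0]; ring
    rw [h1]
    exact Finset.sum_nonpos fun i hi => mul_nonpos_of_nonneg_of_nonpos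
      (hp i (Finset.mem_range.mp hi)) (he i (Finset.mem_range.mp hi))
  -- The constant `e` is the value of `E` at the last index where `c` is positive, so that `c i` and
  -- `E i - e` have opposite signs on both sides. If there is no such index, `c ≤ 0` throughout and
  -- `e = E 0` works.
  by_cases hne : ∃ i < n, 0 < c i ∧ ∀ j, i < j → j < n → c j ≤ 0
  · obtain ⟨i, hi, hpos, hrest⟩ := hne
    refine ⟨E i, fun j hj => ?_⟩
    rcases Nat.lt_or_ge i j with hij | hij
    · exact mul_nonpos_of_nonpos_of_nonneg (hrest j hij hj) (sub_nonneg.2 (hE i j hij.le hj))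
    · exact mul_nonpos_of_nonneg_of_nonpos (hpos.le.trans (hc j i hij hi))
        (sub_nonpos.2 (hE j i hij hi))
  · refine ⟨E 0, fun j hj => ?_⟩
    have hcj : c j ≤ 0 := by
      by_contra! hcj
      apply hne
      set s := (Finset.range n).filter fun i => 0 < c i with hs
      have hsne : s.Nonempty := ⟨j, by simp [hs, hj, hcj]⟩
      have hm := s.max'_mem hsne
      simp only [hs, Finset.mem_filter, Finset.mem_range] at hm
      refine ⟨_, hm.1, hm.2, fun k hk hkn => ?_⟩
      by_contra! hck
      have := s.le_max' k (by simp [hs, hkn, hck])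
      exact absurd hk (not_lt.2 this)
    exact mul_nonpos_of_nonpos_of_nonneg hcj (sub_nonneg.2 (hE 0 j (Nat.zero_le _) hj))

/-! ### Compactness of monotone rules. -/

/-- Helly's selection theorem, with convergence along moving points. -/
lemma exists_subseq_tendsto_of_monotone {L : ℝ} {zs : ℕ → ℝ → ℝ} (hmono : ∀ k, Monotone (zs k))
    (hmem : ∀ k t, zs k t ∈ Icc 0 L) :
    ∃ z : ℝ → ℝ, Monotone z ∧ (∀ t, z t ∈ Icc 0 L) ∧ ∃ φ : ℕ → ℕ, StrictMono φ ∧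
      ∃ N : Set ℝ, N.Countable ∧ ∀ t ∉ N, ∀ s : ℕ → ℝ, Filter.Tendsto s .atTop (nhds t) →
        Filter.Tendsto (fun k => zs (φ k) (s k)) .atTop (nhds (z t)) := by
  obtain ⟨ℓ, hℓ, φ, hφ, hlim⟩ := (isCompact_univ_pi fun _ : ℚ => isCompact_Icc (a := (0 : ℝ))
    (b := L)).tendsto_subseq (x := fun k (q : ℚ) => zs k q) (fun k q _ => hmem k q)
  have hℓ' : ∀ q, ℓ q ∈ Icc 0 L := fun q => hℓ q (mem_univ q)
  have hlim' : ∀ q : ℚ, Filter.Tendsto (fun k => zs (φ k) q) .atTop (nhds (ℓ q)) :=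
    fun q => (tendsto_pi_nhds.1 hlim) q
  have hℓm : ∀ q r : ℚ, q ≤ r → ℓ q ≤ ℓ r := fun q r hqr =>
    le_of_tendsto_of_tendsto' (hlim' q) (hlim' r) fun k => hmono _ (by exact_mod_cast hqr)
  -- The limit on the rationals is extended by its limit from the right; only the countably many
  -- discontinuities of this extension are exceptional.
  let z : ℝ → ℝ := fun t => sInf (ℓ '' {q : ℚ | t < q})
  have hne : ∀ t : ℝ, (ℓ '' {q : ℚ | t < q}).Nonempty := fun t =>
    let ⟨q, hq⟩ := exists_rat_gt t
    ⟨_, q, hq, rfl⟩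
  have hbdd : ∀ t : ℝ, BddBelow (ℓ '' {q : ℚ | t < q}) := fun t =>
    ⟨0, by rintro _ ⟨q, _, rfl⟩; exact (hℓ' q).1⟩
  have hzle : ∀ (t : ℝ) (q : ℚ), t < q → z t ≤ ℓ q := fun t q h => csInf_le (hbdd t) ⟨q, h, rfl⟩
  have hlez : ∀ (t : ℝ) (q : ℚ), (q : ℝ) ≤ t → ℓ q ≤ z t := fun t q h =>
    le_csInf (hne t) (by
      rintro _ ⟨r, hr, rfl⟩
      exact hℓm q r (by exact_mod_cast h.trans (le_of_lt hr)))
  have hzm : Monotone z := fun s t hst =>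
    csInf_le_csInf (hbdd s) (hne t) (image_mono fun q (hq : t < q) => hst.trans_lt hq)
  refine ⟨z, hzm, fun t => ⟨le_csInf (hne t) ?_, ?_⟩, φ, hφ, {t | ¬ ContinuousAt z t},
    hzm.countable_not_continuousAt, fun t ht s hs => ?_⟩
  · rintro _ ⟨q, _, rfl⟩; exact (hℓ' q).1
  · obtain ⟨q, hq⟩ := exists_rat_gt t
    exact (hzle t q hq).trans (hℓ' q).2
  · have hct : ContinuousAt z t := by simpa using ht
    rw [tendsto_order]
    constructor
    -- A rational `q < t` with `ℓ q > a` is eventually below the moving point `s k`, so monotonicity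
    -- bounds the value at `s k` from below; the other half is symmetric.
    · intro a ha
      obtain ⟨l, hlt, hl⟩ := exists_Ioc_subset_of_mem_nhds (hct.eventually (lt_mem_nhds ha))
        (exists_lt t)
      obtain ⟨m, hm1, hm2⟩ := exists_between hlt
      obtain ⟨q, hq1, hq2⟩ := exists_rat_btwn hm2
      have haq : a < ℓ q := (hl ⟨hm1, hm2.le⟩ : a < z m).trans_le (hzle m q hq1)
      filter_upwards [(hlim' q).eventually (lt_mem_nhds haq), hs.eventually (lt_mem_nhds hq2)]
        with k h1 h2
      exact h1.trans_le (hmono _ h2.le)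
    · intro a ha
      obtain ⟨u, hut, hu⟩ := exists_Ico_subset_of_mem_nhds (hct.eventually (gt_mem_nhds ha))
        (exists_gt t)
      obtain ⟨m, hm1, hm2⟩ := exists_between hut
      obtain ⟨q, hq1, hq2⟩ := exists_rat_btwn hm1
      have haq : ℓ q < a := (hlez m q hq2.le).trans_lt (hu ⟨hm1.le, hm2⟩ : z m < a)
      filter_upwards [(hlim' q).eventually (gt_mem_nhds haq), hs.eventually (gt_mem_nhds hq1)]
        with k h1 h2
      exact (hmono _ h2.le).trans_lt h1

/-! ### Surplus chains, information rents and the optimal monotone rule. -/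

/-- A chain of allocations on `[0, L]` with surplus `G`, of derivative `D` in the type, that is
increasing in the type in `[a, b]` and strictly supermodular. -/
structure IsSurplusChain (a b L : ℝ) (G D : ℝ → ℝ → ℝ) : Prop where
  continuous_surplus : Continuous fun q : ℝ × ℝ => G q.1 q.2
  continuous_deriv : Continuous fun q : ℝ × ℝ => D q.1 q.2
  bounded_surplus : ∃ C, ∀ z t, |G z t| ≤ C
  bounded_deriv : ∃ C, ∀ z t, |D z t| ≤ C
  integral_deriv : ∀ z, ∀ s ∈ Icc a b, ∀ t ∈ Icc a b, s ≤ t → ∫ r in s..t, D z r = G z t - G z s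
  monotone_type : ∀ z, ∀ s ∈ Icc a b, ∀ t ∈ Icc a b, s ≤ t → G z s ≤ G z t
  strict_supermodular : ∀ z ∈ Icc 0 L, ∀ z' ∈ Icc 0 L, z < z' → ∀ s ∈ Icc a b, ∀ t ∈ Icc a b,
    s < t → G z t - G z s < G z' t - G z' s

/-- The information rent of type `t` under the allocation rule `z`. -/
noncomputable def infoRent (a : ℝ) (D : ℝ → ℝ → ℝ) (z : ℝ → ℝ) (t : ℝ) : ℝ :=
  ∫ r in a..t, D (z r) r

/-- Expected surplus plus weighted information rents of the allocation rule `z`. -/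
noncomputable def virtualSurplus (μ : Measure ℝ) (a : ℝ) (G D : ℝ → ℝ → ℝ) (c z : ℝ → ℝ) : ℝ :=
  ∫ t, G (z t) t ∂μ + ∫ t, c t * infoRent a D z t ∂μ

namespace IsSurplusChain

variable {a b L : ℝ} {G D : ℝ → ℝ → ℝ}

lemma measurable_surplus (h : IsSurplusChain a b L G D) {z τ : ℝ → ℝ} (hz : Measurable z)
    (hτ : Measurable τ) : Measurable fun t => G (z t) (τ t) :=
  h.continuous_surplus.measurable.comp (hz.prodMk hτ)

lemma measurable_deriv (h : IsSurplusChain a b L G D) {z : ℝ → ℝ} (hz : Measurable z) :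
    Measurable fun t => D (z t) t :=
  h.continuous_deriv.measurable.comp (hz.prodMk measurable_id)

lemma intervalIntegrable_deriv (h : IsSurplusChain a b L G D) {z : ℝ → ℝ} (hz : Measurable z)
    (s t : ℝ) : IntervalIntegrable (fun r => D (z r) r) volume s t := by
  obtain ⟨C, hC⟩ := h.bounded_deriv
  refine (intervalIntegrable_const (c := C)).mono_fun (h.measurable_deriv hz).aestronglyMeasurable
    (Filter.Eventually.of_forall fun r => ?_)
  exact (hC _ _).trans (le_abs_self C)

lemma infoRent_sub (h : IsSurplusChain a b L G D) {z : ℝ → ℝ} (hz : Measurable z) (s t : ℝ) :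
    infoRent a D z t - infoRent a D z s = ∫ r in s..t, D (z r) r :=
  intervalIntegral.integral_interval_sub_left (h.intervalIntegrable_deriv hz _ _)
    (h.intervalIntegrable_deriv hz _ _)

/-- The constant does not depend on the rule. This gives the dominating bound on rents and controls
the effect of moving evaluation points. -/
lemma exists_lipschitz_infoRent (h : IsSurplusChain a b L G D) :
    ∃ C, 0 ≤ C ∧ ∀ z : ℝ → ℝ, Measurable z → ∀ s t,
      |infoRent a D z t - infoRent a D z s| ≤ C * |t - s| := by
  obtain ⟨C, hC⟩ := h.bounded_deriv
  refine ⟨C, (abs_nonneg _).trans (hC 0 0), fun z hz s t => ?_⟩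
  rw [h.infoRent_sub hz, ← Real.norm_eq_abs]
  exact intervalIntegral.norm_integral_le_of_norm_le_const fun r _ => hC (z r) r

lemma continuous_infoRent (h : IsSurplusChain a b L G D) {z : ℝ → ℝ} (hz : Measurable z) :
    Continuous (infoRent a D z) :=
  intervalIntegral.continuous_primitive (fun _ _ => h.intervalIntegrable_deriv hz _ _) a

lemma exists_bound_infoRent (h : IsSurplusChain a b L G D) :
    ∃ C, ∀ z : ℝ → ℝ, Measurable z → ∀ t ∈ Icc a b, |infoRent a D z t| ≤ C := by
  obtain ⟨C, hC0, hC⟩ := h.exists_lipschitz_infoRent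
  refine ⟨C * (b - a), fun z hz t ht => ?_⟩
  have h1 := hC z hz a t
  have h2 : infoRent a D z a = 0 := intervalIntegral.integral_same
  rw [h2, sub_zero, abs_of_nonneg (sub_nonneg.2 ht.1)] at h1
  exact h1.trans (mul_le_mul_of_nonneg_left (by linarith [ht.2]) hC0)

/-- The virtual surplus is continuous along sequences of rules that converge off a countable
set. -/
lemma tendsto_virtualSurplus (h : IsSurplusChain a b L G D) {μ : Measure ℝ}
    [IsProbabilityMeasure μ] [NullSingletonClass μ] {c : ℝ → ℝ}
    (hc : Integrable c μ) {zs : ℕ → ℝ → ℝ} (hzs : ∀ k, Measurable (zs k)) {z : ℝ → ℝ}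
    {N : Set ℝ} (hN : N.Countable)
    (hlim : ∀ t ∉ N, ∀ s : ℕ → ℝ, Filter.Tendsto s .atTop (nhds t) →
      Filter.Tendsto (fun k => zs k (s k)) .atTop (nhds (z t)))
    {τ : ℕ → ℝ → ℝ} (hτm : ∀ k, Measurable (τ k)) (hτ : ∀ k, ∀ᵐ t ∂μ, τ k t ∈ Icc a b)
    (hτlim : ∀ᵐ t ∂μ, Filter.Tendsto (fun k => τ k t) .atTop (nhds t)) :
    Filter.Tendsto (fun k => ∫ t, G (zs k (τ k t)) (τ k t) ∂μ +
      ∫ t, c t * infoRent a D (zs k) (τ k t) ∂μ) .atTop (nhds (virtualSurplus μ a G D c z)) := by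
  have hNμ : ∀ᵐ t ∂μ, t ∉ N := hN.ae_notMem μ
  refine Filter.Tendsto.add ?_ ?_
  · obtain ⟨C, hC⟩ := h.bounded_surplus
    refine tendsto_integral_of_dominated_convergence (fun _ => C)
      (fun k => (h.measurable_surplus ((hzs k).comp (hτm k)) (hτm k)).aestronglyMeasurable)
      (integrable_const _) (fun k => Filter.Eventually.of_forall fun t => hC _ _) ?_
    filter_upwards [hNμ, hτlim] with t ht hτt
    exact (h.continuous_surplus.tendsto (z t, t)).comp ((hlim t ht _ hτt).prodMk_nhds hτt)
  · obtain ⟨C, hC⟩ := h.exists_bound_infoRent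
    obtain ⟨C₁, -, hC₁⟩ := h.exists_lipschitz_infoRent
    obtain ⟨C₂, hC₂⟩ := h.bounded_deriv
    refine tendsto_integral_of_dominated_convergence (fun t => |c t| * C) (fun k => ?_)
      (hc.abs.mul_const C) (fun k => ?_) ?_
    · exact hc.aestronglyMeasurable.mul
        ((h.continuous_infoRent (hzs k)).measurable.comp (hτm k)).aestronglyMeasurable
    · filter_upwards [hτ k] with t ht
      rw [norm_mul]
      exact mul_le_mul_of_nonneg_left (hC _ (hzs k) _ ht) (norm_nonneg _)
    · filter_upwards [hτlim] with t hτt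
      refine Filter.Tendsto.const_mul _ ?_
      -- The rule and the upper endpoint both vary: dominated convergence treats the rule at the
      -- fixed endpoint `t`, and the uniform Lipschitz constant absorbs the move to `τ k t`.
      have h1 : Filter.Tendsto (fun k => infoRent a D (zs k) t) .atTop
          (nhds (infoRent a D z t)) := by
        refine intervalIntegral.tendsto_integral_filter_of_dominated_convergence (fun _ => C₂)
          (Filter.Eventually.of_forall fun k => (h.measurable_deriv (hzs k)).aestronglyMeasurable)
          (Filter.Eventually.of_forall fun k => Filter.Eventually.of_forall fun r _ => hC₂ _ _)
          intervalIntegrable_const ?_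
        filter_upwards [hN.ae_notMem volume] with r hr _
        exact (h.continuous_deriv.tendsto (z r, r)).comp
          ((hlim r hr _ tendsto_const_nhds).prodMk_nhds tendsto_const_nhds)
      have h2 : Filter.Tendsto (fun k => infoRent a D (zs k) (τ k t) - infoRent a D (zs k) t)
          .atTop (nhds 0) := by
        refine squeeze_zero_norm (fun k => hC₁ _ (hzs k) t (τ k t)) ?_
        have h3 : Filter.Tendsto (fun k => C₁ * |τ k t - t|) .atTop (nhds (C₁ * |t - t|)) :=
          ((hτt.sub_const t).abs).const_mul C₁
        simpa using h3
      simpa using h2.add h1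

/-- There is an optimal monotone allocation rule. -/
lemma exists_optimal_monotone (h : IsSurplusChain a b L G D) (hL : 0 ≤ L) {μ : Measure ℝ}
    [IsProbabilityMeasure μ] [NullSingletonClass μ] (hμ : ∀ᵐ t ∂μ, t ∈ Icc a b) {c : ℝ → ℝ}
    (hc : Integrable c μ) :
    ∃ z : ℝ → ℝ, Monotone z ∧ (∀ t, z t ∈ Icc 0 L) ∧
      ∀ z' : ℝ → ℝ, Monotone z' → (∀ t, z' t ∈ Icc 0 L) →
        virtualSurplus μ a G D c z' ≤ virtualSurplus μ a G D c z := by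
  set S : Set ℝ := virtualSurplus μ a G D c '' {z | Monotone z ∧ ∀ t, z t ∈ Icc 0 L} with hS
  have hSne : S.Nonempty := ⟨_, fun _ => 0, ⟨monotone_const, fun _ => ⟨le_rfl, hL⟩⟩, rfl⟩
  obtain ⟨C, hC⟩ := h.bounded_surplus
  obtain ⟨C', hC'⟩ := h.exists_bound_infoRent
  have hSb : BddAbove S := by
    refine ⟨C + ∫ t, |c t| * C' ∂μ, ?_⟩
    rintro _ ⟨z, ⟨hz, _⟩, rfl⟩
    refine add_le_add ?_ ?_
    · refine (Real.le_norm_self _).trans ?_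
      simpa using norm_integral_le_of_norm_le_const (μ := μ) (f := fun t => G (z t) t) (C := C)
        (Filter.Eventually.of_forall fun t => hC (z t) t)
    · refine (Real.le_norm_self _).trans (norm_integral_le_of_norm_le (hc.abs.mul_const C') ?_)
      filter_upwards [hμ] with t ht
      rw [norm_mul]
      exact mul_le_mul_of_nonneg_left (hC' _ hz.measurable _ ht) (norm_nonneg _)
  obtain ⟨u, -, hu, huS⟩ := exists_seq_tendsto_sSup hSne hSb
  choose zs hzs huz using huS
  obtain ⟨z, hzm, hzmem, φ, hφ, N, hN, hlim⟩ :=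
    exists_subseq_tendsto_of_monotone (fun k => (hzs k).1) (fun k => (hzs k).2)
  refine ⟨z, hzm, hzmem, fun z' hz' hz'mem => ?_⟩
  have h1 := h.tendsto_virtualSurplus hc (fun k => (hzs (φ k)).1.measurable) hN
    hlim (τ := fun _ t => t) (fun _ => measurable_id) (fun _ => hμ)
    (Filter.Eventually.of_forall fun t => tendsto_const_nhds)
  have h2 : Filter.Tendsto (fun k => u (φ k)) .atTop (nhds (sSup S)) := hu.comp hφ.tendsto_atTop
  have h3 : virtualSurplus μ a G D c z = sSup S := by
    refine tendsto_nhds_unique h1 ?_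
    simpa only [← huz, virtualSurplus] using h2
  rw [h3]
  exact le_csSup hSb ⟨z', ⟨hz', hz'mem⟩, rfl⟩

end IsSurplusChain

/-! ### Discretization and passage to a continuum of types. -/

/-- A monotone step function with prescribed values between the points `t i`, `i < n`. -/
lemma exists_monotone_step {n : ℕ} {t z : ℕ → ℝ} (ht : ∀ i j, i < j → j < n → t i < t j)
    (hz : ∀ i j, i ≤ j → j < n → z i ≤ z j) :
    ∃ w : ℝ → ℝ, Monotone w ∧ (∀ r, ∃ i, w r = z i) ∧
      ∀ i < n, ∀ r, t i ≤ r → (∀ j, i < j → j < n → r < t j) → w r = z i := by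
  classical
  -- The index counts the points `t j ≤ r`, minus one; below `t 0` truncated subtraction gives index
  -- `0`.
  refine ⟨fun r => z (((Finset.range n).filter fun j => t j ≤ r).card - 1), fun r s hrs => ?_,
    fun r => ⟨_, rfl⟩, fun i hi r hir hr => ?_⟩
  · rcases Nat.eq_zero_or_pos n with rfl | hn
    · simp
    · have h1 : ((Finset.range n).filter fun j => t j ≤ s).card ≤ n :=
        (Finset.card_filter_le _ _).trans (Finset.card_range n).le
      have h2 : ((Finset.range n).filter fun j => t j ≤ r).card ≤
          ((Finset.range n).filter fun j => t j ≤ s).card :=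
        Finset.card_le_card (Finset.monotone_filter_right _ fun j _ hj => le_trans hj hrs)
      exact hz _ _ (by omega) (by omega)
  · have h1 : ((Finset.range n).filter fun j => t j ≤ r) = Finset.range (i + 1) := by
      ext j
      simp only [Finset.mem_filter, Finset.mem_range]
      constructor
      · rintro ⟨hj, hjr⟩
        by_contra! h
        exact absurd (hr j (by omega) hj) (not_lt.2 hjr)
      · intro hj
        refine ⟨by omega, ?_⟩
        rcases Nat.lt_or_ge j i with h | h
        · exact (ht j i h hi).le.trans hir
        · rwa [show j = i by omega]
    simp [h1]

lemma integral_Ico_eq_sum {μ : Measure ℝ} {e : ℕ → ℝ} (he : Monotone e) {F : ℝ → ℝ} (n : ℕ)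
    (hF : ∀ i < n, IntegrableOn F (Ico (e i) (e (i + 1))) μ) :
    IntegrableOn F (Ico (e 0) (e n)) μ ∧
      ∫ t in Ico (e 0) (e n), F t ∂μ = ∑ i ∈ Finset.range n, ∫ t in Ico (e i) (e (i + 1)), F t ∂μ := by
  induction n with
  | zero => simp
  | succ n ih =>
    obtain ⟨h1, h2⟩ := ih fun i hi => hF i (by omega)
    have h3 : Ico (e 0) (e (n + 1)) = Ico (e 0) (e n) ∪ Ico (e n) (e (n + 1)) :=
      (Ico_union_Ico_eq_Ico (he (Nat.zero_le _)) (he (Nat.le_succ _))).symm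
    have h4 := hF n (by omega)
    rw [h3]
    refine ⟨h1.union h4, ?_⟩
    rw [setIntegral_union (Ico_disjoint_Ico_same) measurableSet_Ico h1 h4, h2,
      Finset.sum_range_succ]

/-- The surplus of an arbitrary mechanism is only integrable, so a sample point cannot be chosen
freely; a point where `S` is at least its cell average makes sampling costless. -/
lemma exists_cell_sample {μ : Measure ℝ} [IsFiniteMeasure μ] {S : ℝ → ℝ} (hS : Integrable S μ)
    {s t : ℝ} (hμ : μ (Ico s t) ≠ 0) :
    ∃ x ∈ Ico s t, ∫ r in Ico s t, S r ∂μ ≤ μ.real (Ico s t) * S x := by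
  obtain ⟨x, hx, hle⟩ := exists_setAverage_le hμ (measure_ne_top _ _) hS.integrableOn
  refine ⟨x, hx, ?_⟩
  have hpos : 0 < μ.real (Ico s t) := ENNReal.toReal_pos hμ (measure_ne_top _ _)
  rw [setAverage_eq, smul_eq_mul] at hle
  rwa [← inv_mul_le_iff₀ hpos]

namespace IsSurplusChain

variable {a b L : ℝ} {G D : ℝ → ℝ → ℝ}

/-- The interval is cut into `n` equal cells, each represented by one sampled type, with the cell's
mass as probability and the cell average of `c` as weight. `τ` sends a type to the sample of its
cell. The averaged weights stay antitone with mean zero, so the finite-type lemma and Chebyshev's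
inequality apply. -/
lemma exists_discretization (h : IsSurplusChain a b L G D) (hab : a < b) {μ : Measure ℝ}
    [IsProbabilityMeasure μ] (hμ : ∀ᵐ t ∂μ, t ∈ Ico a b)
    (hpos : ∀ s t, a ≤ s → s < t → t ≤ b → μ (Ico s t) ≠ 0) {c : ℝ → ℝ}
    (hc : Integrable c μ) (hcanti : AntitoneOn c (Icc a b)) (hc0 : ∫ t, c t ∂μ = 0)
    {S U : ℝ → ℝ} (hS : Integrable S μ) (hU : ContinuousOn U (Icc a b))
    (hdown : ∀ s ∈ Icc a b, ∃ ζ ∈ Icc 0 L, S s ≤ G ζ s ∧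
      ∀ r ∈ Icc a b, s < r → G ζ r - G ζ s ≤ U r - U s) {n : ℕ} (hn : 0 < n) :
    ∃ (z τ : ℝ → ℝ), Monotone z ∧ (∀ t, z t ∈ Icc 0 L) ∧ Measurable τ ∧
      (Measurable fun t => U (τ t)) ∧
      (∀ᵐ t ∂μ, τ t ∈ Icc a b ∧ |τ t - t| ≤ (b - a) / n) ∧
      ∫ t, S t ∂μ + ∫ t, c t * U (τ t) ∂μ ≤
        ∫ t, G (z (τ t)) (τ t) ∂μ + ∫ t, c t * infoRent a D z (τ t) ∂μ := by
  set d : ℝ := (b - a) / n with hd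
  have hn' : (0 : ℝ) < n := by exact_mod_cast hn
  have hd0 : 0 < d := div_pos (sub_pos.2 hab) hn'
  have hnd : n * d = b - a := by rw [hd]; field_simp
  set e : ℕ → ℝ := fun i => a + i * d with he
  have hes : StrictMono e := by
    refine strictMono_nat_of_lt_succ fun i => ?_
    simp only [he]; push_cast; linarith
  have he0 : e 0 = a := by simp [he]
  have hen : e n = b := by simp only [he]; linarith
  have hesub : ∀ i < n, ∀ x ∈ Ico (e i) (e (i + 1)), x ∈ Icc a b := fun i hi x hx =>
    ⟨he0 ▸ (hes.monotone (Nat.zero_le i)).trans hx.1,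
      hen ▸ hx.2.le.trans (hes.monotone hi)⟩
  set p : ℕ → ℝ := fun i => μ.real (Ico (e i) (e (i + 1))) with hp
  have hcell : ∀ i < n, μ (Ico (e i) (e (i + 1))) ≠ 0 := fun i hi =>
    hpos _ _ (he0 ▸ hes.monotone (Nat.zero_le i)) (hes (Nat.lt_succ_self i))
      (hen ▸ hes.monotone hi)
  have hppos : ∀ i < n, 0 < p i := fun i hi =>
    ENNReal.toReal_pos (hcell i hi) (measure_ne_top _ _)
  set cb : ℕ → ℝ := fun i => (p i)⁻¹ * ∫ t in Ico (e i) (e (i + 1)), c t ∂μ with hcb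
  have hpcb : ∀ i < n, p i * cb i = ∫ t in Ico (e i) (e (i + 1)), c t ∂μ := fun i hi => by
    simp only [hcb]
    rw [mul_inv_cancel_left₀ (hppos i hi).ne']
  -- sample points
  have hsample : ∀ i, ∃ x ∈ Icc a b, i < n → x ∈ Ico (e i) (e (i + 1)) ∧
      ∫ r in Ico (e i) (e (i + 1)), S r ∂μ ≤ p i * S x := by
    intro i
    by_cases hi : i < n
    · obtain ⟨x, hx, hle⟩ := exists_cell_sample hS (hcell i hi)
      exact ⟨x, hesub i hi x hx, fun _ => ⟨hx, hle⟩⟩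
    -- Indices outside the partition get the dummy sample `a`, so that every `t i` is a type.
    · exact ⟨a, left_mem_Icc.2 hab.le, fun h => absurd h hi⟩
  choose t htI htc using hsample
  have htlt : ∀ i j, i < j → j < n → t i < t j := fun i j hij hj =>
    (htc i (by omega)).1.2.trans_le ((hes.monotone (Nat.succ_le_of_lt hij)).trans (htc j hj).1.1)
  choose ζ hζ hζS hζU using hdown
  obtain ⟨B₀, hB₀⟩ := isCompact_Icc.bddBelow_image hU
  obtain ⟨B₁, hB₁⟩ := isCompact_Icc.bddAbove_image hU
  have hcbanti : ∀ i j, i ≤ j → j < n → cb j ≤ cb i := by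
    intro i j hij hj
    rcases hij.eq_or_lt with rfl | hij'
    · exact le_rfl
    -- The value of `c` at the right end of cell `i` separates the averages over cells `i` and `j`.
    have hm : e (i + 1) ∈ Icc a b := ⟨he0 ▸ hes.monotone (Nat.zero_le _), hen ▸ hes.monotone (by omega)⟩
    have h1 : p i * c (e (i + 1)) ≤ ∫ t in Ico (e i) (e (i + 1)), c t ∂μ := by
      have := setIntegral_mono_on (f := fun _ => c (e (i + 1))) (integrableOn_const (μ := μ)
        (measure_ne_top μ _)) hc.integrableOn (measurableSet_Ico (a := e i) (b := e (i + 1)))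
        fun x hx => hcanti (hesub i (by omega) x hx) hm hx.2.le
      simpa using this
    have h2 : ∫ t in Ico (e j) (e (j + 1)), c t ∂μ ≤ p j * c (e (i + 1)) := by
      have := setIntegral_mono_on (g := fun _ => c (e (i + 1))) hc.integrableOn
        (integrableOn_const (μ := μ) (measure_ne_top μ _))
        (measurableSet_Ico (a := e j) (b := e (j + 1)))
        fun x hx => hcanti hm (hesub j hj x hx) ((hes.monotone hij').trans hx.1)
      simpa using this
    rw [← hpcb i (by omega)] at h1
    rw [← hpcb j hj] at h2
    exact (le_of_mul_le_mul_left h2 (hppos j hj)).trans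
      (le_of_mul_le_mul_left h1 (hppos i (by omega)))
  obtain ⟨z', U', hz', hz'm, hU', hle⟩ := exists_monotone_of_downward (n := n) (L := L) (B₀ := B₀)
    (B₁ := B₁) (G := G) (t := t) (p := p) (c := cb) (z := fun i => ζ (t i) (htI i))
    (U := fun i => U (t i))
    (fun s => h.continuous_surplus.comp (continuous_id.prodMk continuous_const)) hppos hcbanti
    (fun z _ i j hij hj => h.monotone_type z _ (htI i) _ (htI j) (htlt i j hij hj).le)
    (fun z hz z' hz' hzz i j hij hj =>
      h.strict_supermodular z hz z' hz' hzz _ (htI i) _ (htI j) (htlt i j hij hj))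
    (fun i => hζ _ _) (fun i => ⟨hB₀ (mem_image_of_mem _ (htI i)), hB₁ (mem_image_of_mem _ (htI i))⟩)
    (fun i j hij hj => hζU _ (htI i) _ (htI j) (htlt i j hij hj))
  obtain ⟨z, hzm, hzr, hzv⟩ := exists_monotone_step htlt hz'm
  have hzt : ∀ i < n, z (t i) = z' i := fun i hi => hzv i hi _ le_rfl fun j hij hj => htlt i j hij hj
  -- the cell index
  set κ : ℝ → ℕ := fun x => ⌊(x - a) / d⌋₊ with hκ
  have hκm : Measurable κ := Nat.measurable_floor.comp ((measurable_id.sub_const a).div_const d)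
  have hκcell : ∀ i, ∀ x ∈ Ico (e i) (e (i + 1)), κ x = i := by
    intro i x hx
    simp only [he, mem_Ico] at hx
    have h0 : (0 : ℝ) ≤ (x - a) / d :=
      div_nonneg (by nlinarith [hx.1, (Nat.cast_nonneg i : (0 : ℝ) ≤ i)]) hd0.le
    rw [hκ]
    refine (Nat.floor_eq_iff h0).2 ⟨?_, ?_⟩
    · rw [le_div_iff₀ hd0]; linarith
    · rw [div_lt_iff₀ hd0]; push_cast at hx; linarith
  have hcellκ : ∀ x ∈ Ico a b, κ x < n ∧ x ∈ Ico (e (κ x)) (e (κ x + 1)) := by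
    intro x hx
    have h0 : (0 : ℝ) ≤ (x - a) / d := div_nonneg (by linarith [hx.1]) hd0.le
    have h1 : ((κ x : ℕ) : ℝ) ≤ (x - a) / d := Nat.floor_le h0
    have h2 : (x - a) / d < (κ x : ℕ) + 1 := Nat.lt_floor_add_one _
    rw [le_div_iff₀ hd0] at h1
    rw [div_lt_iff₀ hd0] at h2
    have h3 : x ∈ Ico (e (κ x)) (e (κ x + 1)) := by
      simp only [he, mem_Ico]; push_cast; constructor <;> linarith
    refine ⟨?_, h3⟩
    by_contra! h4
    have := hes.monotone h4
    rw [hen] at this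
    exact absurd hx.2 (not_lt.2 (this.trans h3.1))
  have hrestr : μ.restrict (Ico a b) = μ := Measure.restrict_eq_self_of_ae_mem hμ
  have hsum : ∀ (k : ℝ → ℝ), Integrable k μ → ∀ φ : ℕ → ℝ, ∫ x, k x * φ (κ x) ∂μ =
      ∑ i ∈ Finset.range n, (∫ x in Ico (e i) (e (i + 1)), k x ∂μ) * φ i := by
    intro k hk φ
    have hcongr : ∀ i, EqOn (fun x => k x * φ i) (fun x => k x * φ (κ x))
        (Ico (e i) (e (i + 1))) := fun i x hx => by simp only [hκcell i x hx]
    have := (integral_Ico_eq_sum (μ := μ) hes.monotone (F := fun x => k x * φ (κ x)) n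
      fun i _ => (hk.mul_const (φ i)).integrableOn.congr_fun (hcongr i) measurableSet_Ico).2
    rw [he0, hen, hrestr] at this
    rw [this]
    refine Finset.sum_congr rfl fun i _ => ?_
    rw [← setIntegral_congr_fun measurableSet_Ico (hcongr i), integral_mul_const]
  have hsum1 : ∀ φ : ℕ → ℝ, ∫ x, φ (κ x) ∂μ = ∑ i ∈ Finset.range n, p i * φ i := by
    intro φ
    have := hsum (fun _ => 1) (integrable_const _) φ
    simpa [hp] using this
  have hsumc : ∀ φ : ℕ → ℝ, ∫ x, c x * φ (κ x) ∂μ =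
      ∑ i ∈ Finset.range n, p i * (cb i * φ i) := by
    intro φ
    rw [hsum c hc φ]
    exact Finset.sum_congr rfl fun i hi => by
      rw [← hpcb i (Finset.mem_range.1 hi), mul_assoc]
  have hpc0 : ∑ i ∈ Finset.range n, p i * cb i = 0 := by
    have := hsumc fun _ => 1
    simpa [hc0] using this.symm
  refine ⟨z, fun x => t (κ x), hzm, fun r => ?_, measurable_from_nat.comp hκm,
    (measurable_from_nat (f := fun i => U (t i))).comp hκm, ?_, ?_⟩
  · obtain ⟨i, hi⟩ := hzr r
    rw [hi]; exact hz' i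
  · filter_upwards [hμ] with x hx
    obtain ⟨h1, h2⟩ := hcellκ x hx
    refine ⟨htI _, ?_⟩
    have h3 := (htc _ h1).1
    simp only [he, mem_Ico] at h2 h3
    push_cast at h2 h3
    rw [abs_le]
    constructor <;> linarith
  · have e1 : ∫ x, S x ∂μ ≤ ∑ i ∈ Finset.range n, p i * G (ζ (t i) (htI i)) (t i) := by
      have := hsum S hS fun _ => 1
      simp only [mul_one] at this
      rw [this]
      refine Finset.sum_le_sum fun i hi => ?_
      have hi' := Finset.mem_range.1 hi
      exact (htc i hi').2.trans (mul_le_mul_of_nonneg_left (hζS _ _) (hppos i hi').le)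
    -- Between consecutive samples the step rule is constantly `z' j`, so its rent grows by exactly
    -- the lower bound that the downward constraint puts on the growth of `U'`. Hence `U'` minus the
    -- rent is non-decreasing, and replacing `U'` by the rent loses nothing.
    have e2 : ∑ i ∈ Finset.range n, p i * (cb i * (U' i - infoRent a D z (t i))) ≤ 0 := by
      refine sum_mul_nonpos_of_antitone_of_monotone (fun i hi => (hppos i hi).le) hcbanti ?_ hpc0
      intro i j hij
      induction j, hij using Nat.le_induction with
      | base => exact fun _ => le_rfl
      | succ j _ ih =>
        intro hj
        refine (ih (by omega)).trans ?_
        have h1 := hU' j (j + 1) (by omega) hj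
        have h2 := h.infoRent_sub hzm.measurable (t j) (t (j + 1))
        have hlt := htlt j (j + 1) (by omega) hj
        have h3 : ∫ r in (t j)..(t (j + 1)), D (z r) r = ∫ r in (t j)..(t (j + 1)), D (z' j) r := by
          refine intervalIntegral.integral_congr_Ioo_of_le hlt.le fun r hr => ?_
          have : z r = z' j := hzv j (by omega) r hr.1.le fun k hjk hk => by
            rcases (Nat.succ_le_of_lt hjk).eq_or_lt with hk' | hk'
            · rw [← hk']; exact hr.2
            · exact hr.2.trans (htlt _ _ hk' hk)
          simp only [this]
        rw [h3, h.integral_deriv _ _ (htI j) _ (htI (j + 1)) hlt.le] at h2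
        linarith
    rw [hsumc fun i => U (t i), hsum1 fun i => G (z (t i)) (t i),
      hsumc fun i => infoRent a D z (t i)]
    have e3 : ∑ i ∈ Finset.range n, p i * G (z (t i)) (t i) =
        ∑ i ∈ Finset.range n, p i * G (z' i) (t i) :=
      Finset.sum_congr rfl fun i hi => by rw [hzt i (Finset.mem_range.1 hi)]
    simp only [mul_add, mul_sub, Finset.sum_add_distrib, Finset.sum_sub_distrib] at hle e2
    linarith

/-- No allocation rule that satisfies the downward incentive constraints does better than the
optimal monotone rule. -/
lemma exists_monotone_ge_downward (h : IsSurplusChain a b L G D) (hab : a < b) {μ : Measure ℝ}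
    [IsProbabilityMeasure μ] [NullSingletonClass μ] (hμ : ∀ᵐ t ∂μ, t ∈ Icc a b)
    (hpos : ∀ s t, a ≤ s → s < t → t ≤ b → μ (Ico s t) ≠ 0) {c : ℝ → ℝ}
    (hc : Integrable c μ) (hcanti : AntitoneOn c (Icc a b)) (hc0 : ∫ t, c t ∂μ = 0)
    {S U : ℝ → ℝ} (hS : Integrable S μ) (hU : ContinuousOn U (Icc a b))
    (hdown : ∀ s ∈ Icc a b, ∃ ζ ∈ Icc 0 L, S s ≤ G ζ s ∧
      ∀ r ∈ Icc a b, s < r → G ζ r - G ζ s ≤ U r - U s) :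
    ∃ z : ℝ → ℝ, Monotone z ∧ (∀ t, z t ∈ Icc 0 L) ∧
      ∫ t, S t ∂μ + ∫ t, c t * U t ∂μ ≤ virtualSurplus μ a G D c z := by
  -- The cells are half-open, so the null point `b` is discarded.
  have hμ' : ∀ᵐ t ∂μ, t ∈ Ico a b := by
    filter_upwards [hμ, (countable_singleton b).ae_notMem μ] with t ht htb
    exact ⟨ht.1, lt_of_le_of_ne ht.2 htb⟩
  choose zs τ hzm hzmem hτm hUτm hτ hle using fun k : ℕ =>
    h.exists_discretization hab hμ' hpos hc hcanti hc0 hS hU hdown (Nat.succ_pos k)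
  obtain ⟨z, hz, hzI, φ, hφ, N, hN, hlim⟩ := exists_subseq_tendsto_of_monotone hzm hzmem
  refine ⟨z, hz, hzI, ?_⟩
  have hτlim : ∀ᵐ t ∂μ, Filter.Tendsto (fun k => τ k t) .atTop (nhds t) := by
    filter_upwards [ae_all_iff.2 hτ] with t ht
    rw [tendsto_iff_norm_sub_tendsto_zero]
    refine squeeze_zero (fun _ => norm_nonneg _) (fun k => (ht k).2) ?_
    exact (tendsto_const_div_atTop_nhds_zero_nat (b - a)).comp (Filter.tendsto_add_atTop_nat 1)
  have hτφ : ∀ᵐ t ∂μ, Filter.Tendsto (fun k => τ (φ k) t) .atTop (nhds t) := by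
    filter_upwards [hτlim] with t ht
    exact ht.comp hφ.tendsto_atTop
  have hτI : ∀ k, ∀ᵐ t ∂μ, τ k t ∈ Icc a b := fun k => (hτ k).mono fun t ht => ht.1
  have h1 := h.tendsto_virtualSurplus hc (fun k => (hzm (φ k)).measurable) hN hlim
    (fun k => hτm (φ k)) (fun k => hτI (φ k)) hτφ
  obtain ⟨B, hB⟩ := isCompact_Icc.exists_bound_of_continuousOn hU
  have h2 : Filter.Tendsto (fun k => ∫ t, S t ∂μ + ∫ t, c t * U (τ (φ k) t) ∂μ) .atTop
      (nhds (∫ t, S t ∂μ + ∫ t, c t * U t ∂μ)) := by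
    refine tendsto_const_nhds.add ?_
    refine tendsto_integral_of_dominated_convergence (fun t => |c t| * B)
      (fun k => hc.aestronglyMeasurable.mul (hUτm _).aestronglyMeasurable)
      (hc.abs.mul_const B) (fun k => ?_) ?_
    · filter_upwards [hτI (φ k)] with t ht
      rw [norm_mul]
      exact mul_le_mul_of_nonneg_left (hB _ ht) (norm_nonneg _)
    · filter_upwards [hτφ, ae_all_iff.2 hτI, hμ] with t h3 h4 h5
      refine Filter.Tendsto.const_mul _ ?_
      exact (hU t h5).tendsto.comp (tendsto_nhdsWithin_iff.2
        ⟨h3, Filter.Eventually.of_forall fun k => h4 (φ k)⟩)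
  exact le_of_tendsto_of_tendsto' h2 h1 fun k => hle (φ k)

end IsSurplusChain

/-! ### Removing the lotteries. -/

/-- The probability of the allocation in a lottery between the outside option and the allocation
`m`, when the gap below `m` is filled with lotteries. -/
noncomputable def gapWeight (m z : ℝ) : ℝ := max 0 (min (z / m) 1)

/-- The allocation rule obtained from `z` by drawing all lotteries with the common seed `r`. -/
noncomputable def drawLottery (m : ℝ) (z : ℝ → ℝ) (r t : ℝ) : ℝ :=
  if r < gapWeight m (z t) then max (z t) m else 0

lemma continuous_gapWeight (m : ℝ) : Continuous (gapWeight m) :=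
  continuous_const.max ((continuous_id.div_const m).min continuous_const)

lemma monotone_gapWeight {m : ℝ} (hm : 0 < m) : Monotone (gapWeight m) := fun _ _ h =>
  max_le_max le_rfl (min_le_min (div_le_div_of_nonneg_right h hm.le) le_rfl)

lemma gapWeight_mem (m z : ℝ) : gapWeight m z ∈ Icc (0 : ℝ) 1 :=
  ⟨le_max_left _ _, max_le zero_le_one (min_le_right _ _)⟩

/-- The seed is common to all types and the winning threshold increases with the type, so whenever a
lower type wins, all higher types do. -/
lemma monotone_drawLottery {m : ℝ} (hm : 0 < m) {z : ℝ → ℝ} (hz : Monotone z) (r : ℝ) :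
    Monotone (drawLottery m z r) := by
  intro s t hst
  unfold drawLottery
  have h1 := monotone_gapWeight hm (hz hst)
  split_ifs with h2 h3 h3
  · exact max_le_max (hz hst) le_rfl
  · exact absurd (h2.trans_le h1) h3
  · exact hm.le.trans (le_max_right _ _)
  · exact le_rfl

lemma measurable_uncurry_drawLottery {m : ℝ} {z : ℝ → ℝ} (hz : Measurable z) :
    Measurable fun q : ℝ × ℝ => drawLottery m z q.1 q.2 := by
  unfold drawLottery
  refine Measurable.ite ?_ ((hz.comp measurable_snd).max measurable_const) measurable_const
  exact measurableSet_lt measurable_fst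
    ((continuous_gapWeight m).measurable.comp (hz.comp measurable_snd))

/-- `hF` forces `F 0 = 0`, and a uniform seed falls below the threshold with probability `gapWeight
m (z t)`; the expected value of the draw is therefore the right side of `hF`. -/
lemma integral_drawLottery {m : ℝ} {F : ℝ → ℝ → ℝ}
    (hF : ∀ z t, F z t = gapWeight m z * F (max z m) t) (z : ℝ → ℝ) (t s : ℝ) :
    ∫ r in Ico (0 : ℝ) 1, F (drawLottery m z r t) s = F (z t) s := by
  have h0 : F 0 s = 0 := by rw [hF]; simp [gapWeight]
  have hw := gapWeight_mem m (z t)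
  have h1 : ∀ r, F (drawLottery m z r t) s =
      (Iio (gapWeight m (z t))).indicator (fun _ => F (max (z t) m) s) r := by
    intro r
    by_cases h : r < gapWeight m (z t)
    · simp [drawLottery, h]
    · simp [drawLottery, h, h0]
  simp only [h1]
  rw [setIntegral_indicator measurableSet_Iio, setIntegral_const, hF (z t), smul_eq_mul]
  congr 1
  have : Ico (0 : ℝ) 1 ∩ Iio (gapWeight m (z t)) = Ico 0 (gapWeight m (z t)) := by
    ext x
    simp only [mem_inter_iff, mem_Ico, mem_Iio]
    constructor
    · rintro ⟨⟨h1, _⟩, h2⟩; exact ⟨h1, h2⟩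
    · rintro ⟨h1, h2⟩; exact ⟨⟨h1, h2.trans_le hw.2⟩, h2⟩
  rw [this]
  simp [hw.1]

namespace IsSurplusChain

variable {a b L : ℝ} {G D : ℝ → ℝ → ℝ}

/-- The virtual surplus is the average over the seed of those of the drawn rules. -/
lemma integral_virtualSurplus_drawLottery (h : IsSurplusChain a b L G D) {μ : Measure ℝ}
    [IsProbabilityMeasure μ] (hμ : ∀ᵐ t ∂μ, t ∈ Icc a b) {c : ℝ → ℝ} (hc : Integrable c μ) {m : ℝ}
    (hm : 0 < m) (hG : ∀ z t, G z t = gapWeight m z * G (max z m) t)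
    (hD : ∀ z t, D z t = gapWeight m z * D (max z m) t) {z : ℝ → ℝ} (hz : Monotone z) :
    IntegrableOn (fun r => virtualSurplus μ a G D c (drawLottery m z r)) (Ico 0 1) ∧
      ∫ r in Ico (0 : ℝ) 1, virtualSurplus μ a G D c (drawLottery m z r) =
        virtualSurplus μ a G D c z := by
  set ν : Measure ℝ := volume.restrict (Ico 0 1) with hν
  have hzr : ∀ r, Measurable (drawLottery m z r) := fun r => (monotone_drawLottery hm hz r).measurable
  have hdm := measurable_uncurry_drawLottery (m := m) hz.measurable
  obtain ⟨CG, hCG⟩ := h.bounded_surplus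
  obtain ⟨CD, hCD⟩ := h.bounded_deriv
  obtain ⟨CR, hCR⟩ := h.exists_bound_infoRent
  -- surplus
  have i1 : Integrable (fun q : ℝ × ℝ => G (drawLottery m z q.1 q.2) q.2) (ν.prod μ) := by
    refine (integrable_const CG).mono' ?_ (Filter.Eventually.of_forall fun q => hCG _ _)
    exact (h.continuous_surplus.measurable.comp (hdm.prodMk measurable_snd)).aestronglyMeasurable
  have e1 : ∫ r, ∫ t, G (drawLottery m z r t) t ∂μ ∂ν = ∫ t, G (z t) t ∂μ := by
    rw [integral_integral_swap i1]
    exact integral_congr_ae (Filter.Eventually.of_forall fun t => integral_drawLottery hG z t t)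
  -- rents
  have e2 : ∀ t, ∫ r, infoRent a D (drawLottery m z r) t ∂ν = infoRent a D z t := by
    intro t
    have : IsFiniteMeasure ((volume : Measure ℝ).restrict (uIoc a t)) := by
      unfold uIoc; infer_instance
    unfold infoRent
    rw [← intervalIntegral_integral_swap]
    · exact intervalIntegral.integral_congr fun s _ => integral_drawLottery hD z s s
    · refine (integrable_const CD).mono' ?_ (Filter.Eventually.of_forall fun q => hCD _ _)
      exact (h.continuous_deriv.measurable.comp ((hdm.comp measurable_swap).prodMk
        measurable_fst)).aestronglyMeasurable
  have hRm : Measurable (fun q : ℝ × ℝ => infoRent a D (drawLottery m z q.1) q.2) := by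
    -- Joint measurability comes from continuity in the type for each seed and measurability in the
    -- seed for each type.
    have hu : StronglyMeasurable (fun q : ℝ × ℝ => infoRent a D (drawLottery m z q.2) q.1) := by
      refine stronglyMeasurable_uncurry_of_continuous_of_stronglyMeasurable
        (u := fun t r => infoRent a D (drawLottery m z r) t)
        (fun r => h.continuous_infoRent (hzr r)) fun t => ?_
      unfold infoRent
      have hj : StronglyMeasurable (fun q : ℝ × ℝ => D (drawLottery m z q.1 q.2) q.2) :=
        (h.continuous_deriv.measurable.comp (hdm.prodMk measurable_snd)).stronglyMeasurable
      simp only [intervalIntegral]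
      exact hj.integral_prod_right.sub hj.integral_prod_right
    exact hu.measurable.comp measurable_swap
  have i2 : Integrable (fun q : ℝ × ℝ => c q.2 * infoRent a D (drawLottery m z q.1) q.2)
      (ν.prod μ) := by
    refine ((hc.abs.mul_const CR).comp_snd ν).mono' ?_ ?_
    · exact (hc.aestronglyMeasurable.comp_snd).mul hRm.aestronglyMeasurable
    · have : ∀ᵐ q ∂(ν.prod μ), q.2 ∈ Icc a b := Measure.quasiMeasurePreserving_snd.ae hμ
      filter_upwards [this] with q hq
      rw [norm_mul]
      exact mul_le_mul_of_nonneg_left (hCR _ (hzr _) _ hq) (norm_nonneg _)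
  have e3 : ∫ r, ∫ t, c t * infoRent a D (drawLottery m z r) t ∂μ ∂ν =
      ∫ t, c t * infoRent a D z t ∂μ := by
    rw [integral_integral_swap i2]
    refine integral_congr_ae (Filter.Eventually.of_forall fun t => ?_)
    simp only [integral_const_mul, e2]
  refine ⟨i1.integral_prod_left.add i2.integral_prod_left, ?_⟩
  unfold virtualSurplus
  rw [integral_add i1.integral_prod_left i2.integral_prod_left, e1, e3]

/-- Lotteries over the gap below `m` are not needed. -/
lemma exists_monotone_without_lottery (h : IsSurplusChain a b L G D) {μ : Measure ℝ}
    [IsProbabilityMeasure μ] (hμ : ∀ᵐ t ∂μ, t ∈ Icc a b) {c : ℝ → ℝ} (hc : Integrable c μ) {m : ℝ}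
    (hm : 0 < m) (hmL : m ≤ L) (hG : ∀ z t, G z t = gapWeight m z * G (max z m) t)
    (hD : ∀ z t, D z t = gapWeight m z * D (max z m) t) {z : ℝ → ℝ} (hz : Monotone z)
    (hzL : ∀ t, z t ≤ L) :
    ∃ z' : ℝ → ℝ, Monotone z' ∧ (∀ t, z' t ∈ Icc m L ∨ z' t = 0) ∧
      virtualSurplus μ a G D c z ≤ virtualSurplus μ a G D c z' := by
  obtain ⟨hi, he⟩ := h.integral_virtualSurplus_drawLottery hμ hc hm hG hD hz
  have : IsProbabilityMeasure ((volume : Measure ℝ).restrict (Ico 0 1)) := ⟨by simp⟩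
  -- Some seed does at least as well as the average.
  obtain ⟨r, hr⟩ := exists_integral_le hi
  refine ⟨drawLottery m z r, monotone_drawLottery hm hz r, fun t => ?_, he ▸ hr⟩
  unfold drawLottery
  split_ifs
  · exact Or.inl ⟨le_max_right _ _, max_le (hzL t) hmL⟩
  · exact Or.inr rfl

/-! ### Incentive compatibility of monotone rules. -/

/-- By supermodularity the primitive of `D z' - D z` is monotone on `[a, b]`, and its one-sided
derivatives cover the endpoints. -/
lemma deriv_mono (h : IsSurplusChain a b L G D) (hab : a < b) {z z' : ℝ} (hz : z ∈ Icc 0 L)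
    (hz' : z' ∈ Icc 0 L) (hzz : z ≤ z') {t : ℝ} (ht : t ∈ Icc a b) : D z t ≤ D z' t := by
  rcases hzz.eq_or_lt with rfl | hlt
  · exact le_rfl
  have hcD : ∀ y, Continuous fun r => D y r := fun y =>
    h.continuous_deriv.comp (continuous_const.prodMk continuous_id)
  have hmono : MonotoneOn (fun s => ∫ r in a..s, (D z' r - D z r)) (Icc a b) := by
    intro s hs u hu hsu
    have ha : a ∈ Icc a b := left_mem_Icc.2 hab.le
    have h1 : ∀ v ∈ Icc a b, ∫ r in a..v, (D z' r - D z r) =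
        (G z' v - G z' a) - (G z v - G z a) := fun v hv => by
      rw [intervalIntegral.integral_sub ((hcD _).intervalIntegrable _ _)
        ((hcD _).intervalIntegrable _ _), h.integral_deriv _ _ ha _ hv hv.1,
        h.integral_deriv _ _ ha _ hv hv.1]
    simp only [h1 s hs, h1 u hu]
    rcases hsu.eq_or_lt with rfl | hsu'
    · exact le_rfl
    · linarith [h.strict_supermodular z hz z' hz' hlt s hs u hu hsu']
  have hd : HasDerivWithinAt (fun s => ∫ r in a..s, (D z' r - D z r)) (D z' t - D z t)
      (Icc a b) t :=
    (((hcD z').sub (hcD z)).integral_hasStrictDerivAt a t).hasDerivAt.hasDerivWithinAt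
  have h2 := hmono.derivWithin_nonneg (x := t)
  rw [hd.derivWithin (uniqueDiffOn_Icc hab t ht)] at h2
  linarith

/-- Monotone allocation rules with the envelope utility are incentive compatible. -/
lemma infoRent_incentive (h : IsSurplusChain a b L G D) (hab : a < b) {z : ℝ → ℝ}
    (hz : Monotone z) (hzI : ∀ t, z t ∈ Icc 0 L) {s t : ℝ} (hs : s ∈ Icc a b)
    (ht : t ∈ Icc a b) :
    G (z s) t - G (z s) s ≤ infoRent a D z t - infoRent a D z s := by
  have hcD : ∀ y, Continuous fun r => D y r := fun y =>
    h.continuous_deriv.comp (continuous_const.prodMk continuous_id)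
  have hi := h.intervalIntegrable_deriv hz.measurable
  rcases le_total s t with hst | hst
  · rw [h.infoRent_sub hz.measurable, ← h.integral_deriv _ _ hs _ ht hst]
    exact intervalIntegral.integral_mono_on hst ((hcD _).intervalIntegrable _ _) (hi _ _)
      fun r hr => h.deriv_mono hab (hzI _) (hzI _) (hz hr.1) ⟨hs.1.trans hr.1, hr.2.trans ht.2⟩
  · have h1 := h.infoRent_sub hz.measurable t s
    have h2 : ∫ r in t..s, D (z r) r ≤ ∫ r in t..s, D (z s) r :=
      intervalIntegral.integral_mono_on hst (hi _ _) ((hcD _).intervalIntegrable _ _)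
        fun r hr => h.deriv_mono hab (hzI _) (hzI _) (hz hr.2) ⟨ht.1.trans hr.1, hr.2.trans hs.2⟩
    rw [h.integral_deriv _ _ ht _ hs hst] at h2
    linarith

end IsSurplusChain

/-! ### The completed no-ordeal menu as a surplus chain. -/

/-- Truncation of a real number to `[lo, hi]`. -/
noncomputable def truncate (lo hi x : ℝ) : ℝ := max lo (min x hi)

lemma continuous_truncate (lo hi : ℝ) : Continuous (truncate lo hi) :=
  continuous_const.max (continuous_id.min continuous_const)

lemma truncate_mem {lo hi : ℝ} (h : lo ≤ hi) (x : ℝ) : truncate lo hi x ∈ Icc lo hi :=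
  ⟨le_max_left _ _, max_le h (min_le_right _ _)⟩

lemma truncate_of_mem {lo hi x : ℝ} (h : x ∈ Icc lo hi) : truncate lo hi x = x := by
  rw [truncate, min_eq_left h.2, max_eq_right h.1]

lemma monotone_truncate (lo hi : ℝ) : Monotone (truncate lo hi) := fun _ _ h =>
  max_le_max le_rfl (min_le_min h le_rfl)

lemma truncate_max_left (lo hi x : ℝ) (h : lo ≤ hi) : truncate lo hi (max x lo) =
    truncate lo hi x := by
  unfold truncate
  rw [min_max_distrib_right, min_eq_left h, max_comm (min x hi), ← max_assoc, max_self]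

/-- The weight of the truncated income in the chain of menu lotteries. -/
noncomputable def menuWeight (llo z : ℝ) : ℝ := if llo = 0 then 1 else gapWeight llo z

/-- The surplus `l - ψ(l, 0, t)` of the no-ordeal menu, with the gap between the outside option
and `llo` filled with lotteries. -/
noncomputable def menuSurplus (tlo thi llo lhi : ℝ) (ψ : ℝ → ℝ → ℝ → ℝ) (z t : ℝ) : ℝ :=
  menuWeight llo z * grossPayoff ψ (truncate llo lhi z, 0) (truncate tlo thi t)

/-- The derivative of `menuSurplus` in the type. -/
noncomputable def menuDeriv (tlo thi llo lhi : ℝ) (ψ : ℝ → ℝ → ℝ → ℝ) (z t : ℝ) : ℝ :=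
  menuWeight llo z * -derivWithin (ψ (truncate llo lhi z) 0) (Icc tlo thi) (truncate tlo thi t)

lemma continuous_menuWeight (llo : ℝ) : Continuous (menuWeight llo) := by
  unfold menuWeight
  split_ifs
  · exact continuous_const
  · exact continuous_gapWeight llo

lemma menuWeight_mem (llo z : ℝ) : menuWeight llo z ∈ Icc (0 : ℝ) 1 := by
  unfold menuWeight
  split_ifs
  · exact ⟨zero_le_one, le_rfl⟩
  · exact gapWeight_mem _ _

lemma menuWeight_of_le {llo z : ℝ} (h0 : 0 ≤ llo) (h : llo ≤ z) : menuWeight llo z = 1 := by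
  unfold menuWeight gapWeight
  split_ifs with h1
  · rfl
  · have : 0 < llo := lt_of_le_of_ne h0 (Ne.symm h1)
    rw [min_eq_right ((one_le_div this).2 h), max_eq_right zero_le_one]

namespace IsOrdealEnvironment

variable {tlo thi llo lhi : ℝ} {f lam : ℝ → ℝ} {X : Set (ℝ × ℝ)} {ψ : ℝ → ℝ → ℝ → ℝ}

lemma menu_mem (h : IsOrdealEnvironment tlo thi llo lhi f lam X ψ) {l : ℝ}
    (hl : l ∈ Icc llo lhi ∨ l = 0) : (l, (0 : ℝ)) ∈ X :=
  h.noOrdeal_subset ⟨hl, rfl⟩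

/-- The type derivative is bounded on the compact set of allocations and types. The common constant
upgrades continuity in income to joint continuity on the menu, and makes indirect utilities
Lipschitz. -/
lemma exists_lipschitz (h : IsOrdealEnvironment tlo thi llo lhi f lam X ψ) :
    ∃ K : NNReal, ∀ x ∈ X, LipschitzOnWith K (ψ x.1 x.2) (Icc tlo thi) := by
  obtain ⟨C, hC⟩ := (h.compact.prod isCompact_Icc).exists_bound_of_continuousOn
    h.disutility_deriv_continuous
  refine ⟨C.toNNReal, fun x hx => (convex_Icc tlo thi).lipschitzOnWith_of_nnnorm_derivWithin_le
    (h.disutility_differentiable x hx) fun t ht => ?_⟩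
  rw [← NNReal.coe_le_coe, coe_nnnorm]
  exact (hC (x, t) ⟨hx, ht⟩).trans (Real.le_coe_toNNReal C)

lemma continuousOn_menu (h : IsOrdealEnvironment tlo thi llo lhi f lam X ψ) :
    ContinuousOn (fun q : ℝ × ℝ => ψ q.1 0 q.2) (Icc llo lhi ×ˢ Icc tlo thi) := by
  obtain ⟨K, hK⟩ := h.exists_lipschitz
  exact continuousOn_prod_of_continuousOn_lipschitzOnWith' _ K
    (fun l hl => hK _ (h.menu_mem (Or.inl hl))) h.continuous_income

lemma continuous_grossPayoff_truncate (h : IsOrdealEnvironment tlo thi llo lhi f lam X ψ) :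
    Continuous fun q : ℝ × ℝ =>
      grossPayoff ψ (truncate llo lhi q.1, 0) (truncate tlo thi q.2) := by
  have h1 : Continuous fun q : ℝ × ℝ => (truncate llo lhi q.1, truncate tlo thi q.2) :=
    ((continuous_truncate _ _).comp continuous_fst).prodMk
      ((continuous_truncate _ _).comp continuous_snd)
  exact ((continuous_truncate _ _).comp continuous_fst).sub (h.continuousOn_menu.comp_continuous h1
    fun q => ⟨truncate_mem h.income_le _, truncate_mem h.type_lt.le _⟩)

lemma continuous_derivWithin_truncate (h : IsOrdealEnvironment tlo thi llo lhi f lam X ψ) :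
    Continuous fun q : ℝ × ℝ =>
      -derivWithin (ψ (truncate llo lhi q.1) 0) (Icc tlo thi) (truncate tlo thi q.2) := by
  have h1 : Continuous fun q : ℝ × ℝ =>
      ((truncate llo lhi q.1, (0 : ℝ)), truncate tlo thi q.2) :=
    (((continuous_truncate _ _).comp continuous_fst).prodMk continuous_const).prodMk
      ((continuous_truncate _ _).comp continuous_snd)
  exact (h.disutility_deriv_continuous.comp_continuous h1 fun q =>
    ⟨h.menu_mem (Or.inl (truncate_mem h.income_le _)), truncate_mem h.type_lt.le _⟩).neg

lemma menu_increment_nonneg (h : IsOrdealEnvironment tlo thi llo lhi f lam X ψ) {x : ℝ × ℝ}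
    (hx : x ∈ X) {s t : ℝ} (hs : s ∈ Icc tlo thi) (ht : t ∈ Icc tlo thi) (hst : s ≤ t) :
    grossPayoff ψ x s ≤ grossPayoff ψ x t :=
  sub_le_sub_left (h.disutility_antitone x hx hs ht hst) _

/-- At genuine menu points the completion changes nothing: the weight is one from `llo` on, and when
`0` lies below `llo` the zero weight agrees with the zero payoff of the outside option. -/
lemma menuSurplus_eq (h : IsOrdealEnvironment tlo thi llo lhi f lam X ψ) {l : ℝ}
    (hl : l ∈ Icc llo lhi ∨ l = 0) {t : ℝ} (ht : t ∈ Icc tlo thi) :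
    menuSurplus tlo thi llo lhi ψ l t = grossPayoff ψ (l, 0) t := by
  unfold menuSurplus
  rw [truncate_of_mem ht]
  by_cases hl' : l ∈ Icc llo lhi
  · rw [menuWeight_of_le h.income_nonneg hl'.1, truncate_of_mem hl', one_mul]
  · have hl0 : l = 0 := hl.resolve_left hl'
    subst hl0
    have hne : llo ≠ 0 := by
      rintro rfl
      exact hl' ⟨le_rfl, h.income_le⟩
    rw [menuWeight, if_neg hne, gapWeight]
    simp [grossPayoff, h.disutility_zero t ht]

lemma menuSurplus_of_pos (hlo : 0 < llo) (hle : llo ≤ lhi) (z t : ℝ) :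
    menuSurplus tlo thi llo lhi ψ z t =
      gapWeight llo z * menuSurplus tlo thi llo lhi ψ (max z llo) t := by
  unfold menuSurplus
  rw [menuWeight_of_le hlo.le (le_max_right z llo), one_mul, truncate_max_left _ _ _ hle,
    menuWeight, if_neg hlo.ne']

lemma menuDeriv_of_pos (hlo : 0 < llo) (hle : llo ≤ lhi) (z t : ℝ) :
    menuDeriv tlo thi llo lhi ψ z t =
      gapWeight llo z * menuDeriv tlo thi llo lhi ψ (max z llo) t := by
  unfold menuDeriv
  rw [menuWeight_of_le hlo.le (le_max_right z llo), one_mul, truncate_max_left _ _ _ hle,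
    menuWeight, if_neg hlo.ne']

lemma menu_increment_strict (h : IsOrdealEnvironment tlo thi llo lhi f lam X ψ) {l l' : ℝ}
    (hl : l ∈ Icc llo lhi) (hl' : l' ∈ Icc llo lhi) (hll : l < l') {s t : ℝ}
    (hs : s ∈ Icc tlo thi) (ht : t ∈ Icc tlo thi) (hst : s < t) :
    grossPayoff ψ (l, 0) t - grossPayoff ψ (l, 0) s <
      grossPayoff ψ (l', 0) t - grossPayoff ψ (l', 0) s := by
  have := h.strictSubmodular l hl l' hl' s hs t ht hll hst
  simp only [grossPayoff] at this ⊢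
  linarith

/-- Above the gap this is the strict submodularity of `ψ`. Inside the gap the increment is the
weight times the increment at `llo`, which is positive because `ψ` is strictly decreasing there; a
larger `z'` has a strictly larger weight and an increment at least that of `llo`. -/
lemma menuSurplus_strict_supermodular (h : IsOrdealEnvironment tlo thi llo lhi f lam X ψ)
    {z z' : ℝ} (hz : z ∈ Icc 0 lhi) (hz' : z' ∈ Icc 0 lhi) (hzz : z < z') {s t : ℝ}
    (hs : s ∈ Icc tlo thi) (ht : t ∈ Icc tlo thi) (hst : s < t) :
    menuSurplus tlo thi llo lhi ψ z t - menuSurplus tlo thi llo lhi ψ z s <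
      menuSurplus tlo thi llo lhi ψ z' t - menuSurplus tlo thi llo lhi ψ z' s := by
  rcases le_or_gt llo z with hlz | hlz
  · have hzI : z ∈ Icc llo lhi := ⟨hlz, hz.2⟩
    have hzI' : z' ∈ Icc llo lhi := ⟨hlz.trans hzz.le, hz'.2⟩
    rw [h.menuSurplus_eq (Or.inl hzI) hs, h.menuSurplus_eq (Or.inl hzI) ht,
      h.menuSurplus_eq (Or.inl hzI') hs, h.menuSurplus_eq (Or.inl hzI') ht]
    exact h.menu_increment_strict hzI hzI' hzz hs ht hst
  have hlo : 0 < llo := hz.1.trans_lt hlz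
  set m := max z' llo with hm
  have hmI : m ∈ Icc llo lhi := ⟨le_max_right _ _, max_le hz'.2 h.income_le⟩
  have hlI : llo ∈ Icc llo lhi := ⟨le_rfl, h.income_le⟩
  rw [menuSurplus_of_pos hlo h.income_le z, menuSurplus_of_pos hlo h.income_le z,
    menuSurplus_of_pos hlo h.income_le z', menuSurplus_of_pos hlo h.income_le z',
    max_eq_right hlz.le, ← hm, h.menuSurplus_eq (Or.inl hlI) hs, h.menuSurplus_eq (Or.inl hlI) ht,
    h.menuSurplus_eq (Or.inl hmI) hs, h.menuSurplus_eq (Or.inl hmI) ht, ← mul_sub, ← mul_sub]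
  have hpos : 0 < grossPayoff ψ (llo, 0) t - grossPayoff ψ (llo, 0) s := by
    have := h.disutility_strictAnti _ (h.menu_mem (Or.inl hlI)) hlo hs ht hst
    simp only [grossPayoff]; linarith
  have hinc : grossPayoff ψ (llo, 0) t - grossPayoff ψ (llo, 0) s ≤
      grossPayoff ψ (m, 0) t - grossPayoff ψ (m, 0) s := by
    rcases hmI.1.eq_or_lt with h1 | h1
    · rw [← h1]
    · exact (h.menu_increment_strict hlI hmI h1 hs ht hst).le
  have hw : gapWeight llo z < gapWeight llo z' := by
    unfold gapWeight
    have h1 : 0 ≤ z / llo := div_nonneg hz.1 hlo.le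
    have h2 : z / llo < 1 := (div_lt_one hlo).2 hlz
    have h3 : z / llo < z' / llo := div_lt_div_of_pos_right hzz hlo
    rw [min_eq_left h2.le, max_eq_right h1]
    exact lt_max_of_lt_right (lt_min h3 h2)
  calc _ < gapWeight llo z' * (grossPayoff ψ (llo, 0) t - grossPayoff ψ (llo, 0) s) :=
        mul_lt_mul_of_pos_right hw hpos
    _ ≤ _ := mul_le_mul_of_nonneg_left hinc (gapWeight_mem _ _).1

/-- The no-ordeal menu, completed with lotteries, is a chain. -/
lemma isSurplusChain (h : IsOrdealEnvironment tlo thi llo lhi f lam X ψ) :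
    IsSurplusChain tlo thi lhi (menuSurplus tlo thi llo lhi ψ) (menuDeriv tlo thi llo lhi ψ) where
  continuous_surplus :=
    ((continuous_menuWeight llo).comp continuous_fst).mul h.continuous_grossPayoff_truncate
  continuous_deriv :=
    ((continuous_menuWeight llo).comp continuous_fst).mul h.continuous_derivWithin_truncate
  bounded_surplus := by
    obtain ⟨C, hC⟩ := (isCompact_Icc.prod isCompact_Icc).exists_bound_of_continuousOn
      (s := Icc llo lhi ×ˢ Icc tlo thi) h.continuous_grossPayoff_truncate.continuousOn
    refine ⟨C, fun z t => ?_⟩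
    have h1 := hC (truncate llo lhi z, truncate tlo thi t)
      ⟨truncate_mem h.income_le z, truncate_mem h.type_lt.le t⟩
    simp only [truncate_of_mem (truncate_mem h.income_le z),
      truncate_of_mem (truncate_mem h.type_lt.le t)] at h1
    have hw := menuWeight_mem llo z
    rw [menuSurplus, abs_mul, abs_of_nonneg hw.1]
    exact (mul_le_of_le_one_left (abs_nonneg _) hw.2).trans h1
  bounded_deriv := by
    obtain ⟨C, hC⟩ := (isCompact_Icc.prod isCompact_Icc).exists_bound_of_continuousOn
      (s := Icc llo lhi ×ˢ Icc tlo thi) h.continuous_derivWithin_truncate.continuousOn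
    refine ⟨C, fun z t => ?_⟩
    have h1 := hC (truncate llo lhi z, truncate tlo thi t)
      ⟨truncate_mem h.income_le z, truncate_mem h.type_lt.le t⟩
    simp only [truncate_of_mem (truncate_mem h.income_le z),
      truncate_of_mem (truncate_mem h.type_lt.le t)] at h1
    have hw := menuWeight_mem llo z
    rw [menuDeriv, abs_mul, abs_of_nonneg hw.1]
    exact (mul_le_of_le_one_left (abs_nonneg _) hw.2).trans h1
  integral_deriv := fun z s hs t ht hst => by
    have hx : (truncate llo lhi z, (0 : ℝ)) ∈ X := h.menu_mem (Or.inl (truncate_mem h.income_le z))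
    have hd := h.disutility_differentiable _ hx
    have hsub : Icc s t ⊆ Icc tlo thi := Icc_subset_Icc hs.1 ht.2
    have hcont : Continuous fun r =>
        -derivWithin (ψ (truncate llo lhi z) 0) (Icc tlo thi) (truncate tlo thi r) :=
      h.continuous_derivWithin_truncate.comp (continuous_const.prodMk continuous_id)
    have key : ∫ r in s..t, -derivWithin (ψ (truncate llo lhi z) 0) (Icc tlo thi)
        (truncate tlo thi r) = -ψ (truncate llo lhi z) 0 t - -ψ (truncate llo lhi z) 0 s := by
      refine intervalIntegral.integral_eq_sub_of_hasDerivAt_of_le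
        (f := fun r => -ψ (truncate llo lhi z) 0 r) hst (hd.continuousOn.mono hsub).neg
        (fun r hr => ?_) (hcont.intervalIntegrable _ _)
      have hr' : r ∈ Icc tlo thi := hsub (Ioo_subset_Icc_self hr)
      rw [truncate_of_mem hr']
      exact ((hd r hr').hasDerivWithinAt.hasDerivAt
        (Icc_mem_nhds (hs.1.trans_lt hr.1) (hr.2.trans_le ht.2))).neg
    simp only [menuDeriv, menuSurplus, grossPayoff, truncate_of_mem hs, truncate_of_mem ht,
      intervalIntegral.integral_const_mul]
    rw [key]
    ring
  monotone_type := fun z s hs t ht hst => by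
    simp only [menuSurplus, truncate_of_mem hs, truncate_of_mem ht]
    exact mul_le_mul_of_nonneg_left (h.menu_increment_nonneg
      (h.menu_mem (Or.inl (truncate_mem h.income_le z))) hs ht hst) (menuWeight_mem _ _).1
  strict_supermodular := fun z hz z' hz' hzz s hs t ht hst =>
    h.menuSurplus_strict_supermodular hz hz' hzz hs ht hst

/-! ### Replacing ordeals by points of the chain. -/

/-- Every allocation can be replaced, from the point of view of a given type, by an element of the
no-ordeal chain that is at least as efficient and less attractive to higher types. -/
lemma exists_menu_replacement_of_antitone (h : IsOrdealEnvironment tlo thi llo lhi f lam X ψ)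
    (hcond : OrdealCostAntitone tlo thi X ψ) {x : ℝ × ℝ} (hx : x ∈ X) {s : ℝ}
    (hs : s ∈ Icc tlo thi) :
    ∃ ζ ∈ Icc 0 lhi, grossPayoff ψ x s ≤ menuSurplus tlo thi llo lhi ψ ζ s ∧
      ∀ r ∈ Icc tlo thi, s < r → menuSurplus tlo thi llo lhi ψ ζ r -
        menuSurplus tlo thi llo lhi ψ ζ s ≤ grossPayoff ψ x r - grossPayoff ψ x s := by
  have hl := h.income_mem x hx
  have hlI : x.1 ∈ Icc 0 lhi := by
    rcases hl with hl | hl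
    · exact ⟨h.income_nonneg.trans hl.1, hl.2⟩
    · rw [hl]; exact ⟨le_rfl, h.income_nonneg.trans h.income_le⟩
  -- Removing the ordeal at the same income saves its cost, and since that cost falls with ability,
  -- the payoff rises less towards higher types.
  refine ⟨x.1, hlI, ?_, fun r hr hsr => ?_⟩
  · rw [h.menuSurplus_eq hl hs]
    exact sub_le_sub_left (h.ordeal_costly x hx s hs) _
  · rw [h.menuSurplus_eq hl hs, h.menuSurplus_eq hl hr]
    have := hcond x hx hs hr hsr.le
    simp only [grossPayoff] at this ⊢
    linarith

/-- Mere removal of the ordeal may tempt higher types. Instead one moves down the chain to a `ζ`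
that gives type `s` exactly the surplus of `x`. From `s` to `r`, the surplus at `ζ` grows by a
factor no larger than at `(x.1, 0)` by log-supermodularity, which is no larger than at `x` by the
ratio condition. -/
lemma exists_menu_replacement_of_ratio (h : IsOrdealEnvironment tlo thi llo lhi f lam X ψ)
    (hcond : SurplusRatioCondition tlo thi llo lhi X ψ) {x : ℝ × ℝ} (hx : x ∈ X) {s : ℝ}
    (hs : s ∈ Icc tlo thi) :
    ∃ ζ ∈ Icc 0 lhi, grossPayoff ψ x s ≤ menuSurplus tlo thi llo lhi ψ ζ s ∧
      ∀ r ∈ Icc tlo thi, s < r → menuSurplus tlo thi llo lhi ψ ζ r -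
        menuSurplus tlo thi llo lhi ψ ζ s ≤ grossPayoff ψ x r - grossPayoff ψ x s := by
  obtain ⟨hlog, hnn, hratio⟩ := hcond
  have h0 : ∀ t ∈ Icc tlo thi, menuSurplus tlo thi llo lhi ψ 0 t = 0 := fun t ht => by
    rw [h.menuSurplus_eq (Or.inr rfl) ht]
    simp [grossPayoff, h.disutility_zero t ht]
  have hv0 : 0 ≤ grossPayoff ψ x s := hnn x hx s hs
  have hvle : grossPayoff ψ x s ≤ grossPayoff ψ (x.1, 0) s :=
    sub_le_sub_left (h.ordeal_costly x hx s hs) _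
  rcases hv0.eq_or_lt with hv | hv
  · refine ⟨0, ⟨le_rfl, h.income_nonneg.trans h.income_le⟩, by rw [h0 s hs, hv], fun r hr _ => ?_⟩
    rw [h0 s hs, h0 r hr, ← hv]
    simpa [grossPayoff] using hnn x hx r hr
  have hl : x.1 ∈ Icc llo lhi := by
    refine (h.income_mem x hx).resolve_right fun hx0 => ?_
    have h2 : grossPayoff ψ (x.1, 0) s = 0 := by
      simp [grossPayoff, hx0, h.disutility_zero s hs]
    linarith
  have hgl := fun t ht => h.menuSurplus_eq (t := t) (Or.inl hl) ht
  obtain ⟨ζ, hζ, hζs⟩ := intermediate_value_Icc (h.income_nonneg.trans hl.1)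
    (f := fun z => menuSurplus tlo thi llo lhi ψ z s)
    (h.isSurplusChain.continuous_surplus.comp (continuous_id.prodMk continuous_const)).continuousOn
    (show grossPayoff ψ x s ∈ Icc _ _ from ⟨(h0 s hs).trans_le hv0, (hgl s hs).symm ▸ hvle⟩)
  simp only at hζs
  refine ⟨ζ, ⟨hζ.1, hζ.2.trans hl.2⟩, hζs.ge, fun r hr hsr => ?_⟩
  rw [hζs]
  refine sub_le_sub_right ?_ _
  have hgs : 0 < grossPayoff ψ (x.1, 0) s := hv.trans_le hvle
  have hgr : 0 < grossPayoff ψ (x.1, 0) r :=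
    hgs.trans_le (h.menu_increment_nonneg (h.menu_mem (Or.inl hl)) hs hr hsr.le)
  -- log-supermodularity along the completed menu
  have hlog' : menuSurplus tlo thi llo lhi ψ ζ r * grossPayoff ψ (x.1, 0) s ≤
      menuSurplus tlo thi llo lhi ψ ζ s * grossPayoff ψ (x.1, 0) r := by
    have hbase : ∀ y ∈ Icc llo lhi, y ≤ x.1 →
        grossPayoff ψ (y, 0) r * grossPayoff ψ (x.1, 0) s ≤
          grossPayoff ψ (y, 0) s * grossPayoff ψ (x.1, 0) r := by
      intro y hy hyl
      rcases hyl.eq_or_lt with rfl | hlt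
      · exact (mul_comm _ _).le
      · exact hlog y hy x.1 hl s hs r hr hlt hsr
    -- For `ζ` in the gap the comparison is made at `llo`; the lottery weight is a common factor of
    -- both types' surpluses.
    have htr : truncate llo lhi ζ ≤ x.1 := by
      have := monotone_truncate llo lhi hζ.2
      rwa [truncate_of_mem hl] at this
    have := mul_le_mul_of_nonneg_left (hbase _ (truncate_mem h.income_le ζ) htr)
      (menuWeight_mem llo ζ).1
    simp only [menuSurplus, truncate_of_mem hs, truncate_of_mem hr]
    linarith
  have hrat : grossPayoff ψ x s / grossPayoff ψ (x.1, 0) s ≤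
      grossPayoff ψ x r / grossPayoff ψ (x.1, 0) r := hratio x hx hs hr hsr.le
  rw [div_le_div_iff₀ hgs hgr] at hrat
  rw [hζs] at hlog'
  exact le_of_mul_le_mul_right (hlog'.trans hrat) hgs

end IsOrdealEnvironment

/-! ### The law of the type. -/

section TypeLaw

variable {tlo thi : ℝ} {f : ℝ → ℝ}

lemma typeLaw_absolutelyContinuous : typeLaw tlo thi f ≪ volume.restrict (Icc tlo thi) :=
  withDensity_absolutelyContinuous _ _

lemma ae_mem_typeLaw : ∀ᵐ t ∂(typeLaw tlo thi f), t ∈ Icc tlo thi :=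
  typeLaw_absolutelyContinuous.ae_le (ae_restrict_mem measurableSet_Icc)

lemma nullSingletonClass_typeLaw : NullSingletonClass (typeLaw tlo thi f) :=
  ⟨fun x => typeLaw_absolutelyContinuous (measure_singleton x)⟩

lemma isProbabilityMeasure_typeLaw (hf : ContinuousOn f (Icc tlo thi))
    (hpos : ∀ t ∈ Icc tlo thi, 0 < f t) (hint : ∫ t in Icc tlo thi, f t = 1) :
    IsProbabilityMeasure (typeLaw tlo thi f) := by
  refine ⟨?_⟩
  rw [typeLaw, withDensity_apply _ MeasurableSet.univ, Measure.restrict_univ,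
    ← ofReal_integral_eq_lintegral_ofReal (hf.integrableOn_compact isCompact_Icc), hint,
    ENNReal.ofReal_one]
  filter_upwards [ae_restrict_mem measurableSet_Icc] with t ht
  exact (hpos t ht).le

lemma typeLaw_Ico_ne_zero (hf : ContinuousOn f (Icc tlo thi))
    (hpos : ∀ t ∈ Icc tlo thi, 0 < f t) {s t : ℝ} (hs : tlo ≤ s) (hst : s < t) (ht : t ≤ thi) :
    typeLaw tlo thi f (Ico s t) ≠ 0 := by
  have hsub : Ico s t ⊆ Icc tlo thi := fun r hr => ⟨hs.trans hr.1, hr.2.le.trans ht⟩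
  rw [typeLaw, withDensity_apply _ measurableSet_Ico, Measure.restrict_restrict measurableSet_Ico,
    inter_eq_left.2 hsub]
  have hm : AEMeasurable (fun r => ENNReal.ofReal (f r)) (volume.restrict (Ico s t)) :=
    ((hf.mono hsub).aemeasurable measurableSet_Ico).ennreal_ofReal
  intro h0
  rw [lintegral_eq_zero_iff' hm] at h0
  have h1 : ∀ᵐ r ∂(volume.restrict (Ico s t)), False := by
    filter_upwards [h0, ae_restrict_mem measurableSet_Ico] with r hr hrI
    exact (ENNReal.ofReal_pos.2 (hpos r (hsub hrI))).ne' hr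
  have h2 : volume (Ico s t) = 0 := by
    rwa [Filter.eventually_false_iff_eq_bot, ae_eq_bot, Measure.restrict_eq_zero] at h1
  rw [Real.volume_Ico, ENNReal.ofReal_eq_zero] at h2
  linarith

lemma ContinuousOn.integrable_typeLaw [IsFiniteMeasure (typeLaw tlo thi f)] {g : ℝ → ℝ}
    (hg : ContinuousOn g (Icc tlo thi)) : Integrable g (typeLaw tlo thi f) := by
  have h := hg.integrableOn_compact (μ := typeLaw tlo thi f) isCompact_Icc
  rwa [IntegrableOn, Measure.restrict_eq_self_of_ae_mem ae_mem_typeLaw] at h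

end TypeLaw

/-! ### Optimality of the no-ordeal menu in both problems. -/

namespace IsOrdealEnvironment

variable {tlo thi llo lhi : ℝ} {f lam : ℝ → ℝ} {X : Set (ℝ × ℝ)} {ψ : ℝ → ℝ → ℝ → ℝ}

lemma isProbabilityMeasure (h : IsOrdealEnvironment tlo thi llo lhi f lam X ψ) :
    IsProbabilityMeasure (typeLaw tlo thi f) :=
  isProbabilityMeasure_typeLaw h.density_continuous h.density_pos h.density_integral

/-- Indirect utilities of incentive compatible mechanisms are Lipschitz continuous. -/
lemma continuousOn_utility (h : IsOrdealEnvironment tlo thi llo lhi f lam X ψ) {x : ℝ → ℝ × ℝ}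
    {T : ℝ → ℝ} (hm : IsICMechanism tlo thi X ψ x T) :
    ContinuousOn (fun t => grossPayoff ψ (x t) t - T t) (Icc tlo thi) := by
  obtain ⟨K, hK⟩ := h.exists_lipschitz
  have key : ∀ s ∈ Icc tlo thi, ∀ t ∈ Icc tlo thi,
      (grossPayoff ψ (x s) s - T s) - (grossPayoff ψ (x t) t - T t) ≤ K * |s - t| := by
    intro s hs t ht
    have h1 := hm.ic t ht s hs
    have h2 := (hK _ (hm.mem s hs)).dist_le_mul t ht s hs
    rw [Real.dist_eq, Real.dist_eq, abs_sub_comm t s] at h2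
    have h3 := le_abs_self (ψ (x s).1 (x s).2 t - ψ (x s).1 (x s).2 s)
    simp only [grossPayoff] at h1 ⊢
    linarith
  refine LipschitzOnWith.continuousOn (K := K) (LipschitzOnWith.of_dist_le_mul fun s hs t ht => ?_)
  rw [Real.dist_eq, Real.dist_eq, abs_le]
  have h1 := key s hs t ht
  have h2 := key t ht s hs
  rw [abs_sub_comm t s] at h2
  constructor <;> linarith

lemma exists_menu_replacement (h : IsOrdealEnvironment tlo thi llo lhi f lam X ψ)
    (hcond : OrdealCostAntitone tlo thi X ψ ∨ SurplusRatioCondition tlo thi llo lhi X ψ)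
    {x : ℝ × ℝ} (hx : x ∈ X) {s : ℝ} (hs : s ∈ Icc tlo thi) :
    ∃ ζ ∈ Icc 0 lhi, grossPayoff ψ x s ≤ menuSurplus tlo thi llo lhi ψ ζ s ∧
      ∀ r ∈ Icc tlo thi, s < r → menuSurplus tlo thi llo lhi ψ ζ r -
        menuSurplus tlo thi llo lhi ψ ζ s ≤ grossPayoff ψ x r - grossPayoff ψ x s :=
  hcond.elim (fun hc => h.exists_menu_replacement_of_antitone hc hx hs)
    fun hc => h.exists_menu_replacement_of_ratio hc hx hs

lemma integrable_surplus (h : IsOrdealEnvironment tlo thi llo lhi f lam X ψ) {x : ℝ → ℝ × ℝ}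
    {T : ℝ → ℝ} (hm : IsICMechanism tlo thi X ψ x T) (hT : Integrable T (typeLaw tlo thi f)) :
    Integrable (fun t => grossPayoff ψ (x t) t) (typeLaw tlo thi f) := by
  have := h.isProbabilityMeasure
  exact ((h.continuousOn_utility hm).integrable_typeLaw.add hT).congr
    (Filter.Eventually.of_forall fun t => sub_add_cancel _ _)

/-- Welfare plus revenue is surplus plus weighted utility. -/
lemma weightedWelfare_add_revenue (h : IsOrdealEnvironment tlo thi llo lhi f lam X ψ) {w : ℝ → ℝ}
    (hw : ContinuousOn w (Icc tlo thi)) {x : ℝ → ℝ × ℝ} {T : ℝ → ℝ}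
    (hm : IsICMechanism tlo thi X ψ x T) (hT : Integrable T (typeLaw tlo thi f)) :
    weightedWelfare (typeLaw tlo thi f) w ψ x T + ∫ t, T t ∂(typeLaw tlo thi f) =
      ∫ t, grossPayoff ψ (x t) t ∂(typeLaw tlo thi f) +
        ∫ t, (w t - 1) * (grossPayoff ψ (x t) t - T t) ∂(typeLaw tlo thi f) := by
  have := h.isProbabilityMeasure
  have hU := h.continuousOn_utility hm
  have h1 : Integrable (fun t => w t * (grossPayoff ψ (x t) t - T t)) (typeLaw tlo thi f) :=
    (hw.mul hU).integrable_typeLaw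
  have h2 : Integrable (fun t => (w t - 1) * (grossPayoff ψ (x t) t - T t))
      (typeLaw tlo thi f) := ((hw.sub continuousOn_const).mul hU).integrable_typeLaw
  rw [weightedWelfare, ← integral_add h1 hT, ← integral_add (h.integrable_surplus hm hT) h2]
  exact integral_congr_ae (Filter.Eventually.of_forall fun t => by ring)

/-- There is an optimal monotone allocation rule without lotteries in the no-ordeal chain. -/
lemma exists_optimal_menu_rule (h : IsOrdealEnvironment tlo thi llo lhi f lam X ψ) {c : ℝ → ℝ}
    (hc : Integrable c (typeLaw tlo thi f)) :
    ∃ z : ℝ → ℝ, Monotone z ∧ (∀ t, z t ∈ Icc llo lhi ∨ z t = 0) ∧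
      ∀ z' : ℝ → ℝ, Monotone z' → (∀ t, z' t ∈ Icc 0 lhi) →
        virtualSurplus (typeLaw tlo thi f) tlo (menuSurplus tlo thi llo lhi ψ)
          (menuDeriv tlo thi llo lhi ψ) c z' ≤
        virtualSurplus (typeLaw tlo thi f) tlo (menuSurplus tlo thi llo lhi ψ)
          (menuDeriv tlo thi llo lhi ψ) c z := by
  have := h.isProbabilityMeasure
  have := nullSingletonClass_typeLaw (tlo := tlo) (thi := thi) (f := f)
  obtain ⟨z, hz, hzI, hopt⟩ := h.isSurplusChain.exists_optimal_monotone
    (h.income_nonneg.trans h.income_le) ae_mem_typeLaw hc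
  rcases h.income_nonneg.eq_or_lt with h0 | hpos
  -- With `llo = 0` there is no gap and no lottery to remove.
  · exact ⟨z, hz, fun t => Or.inl (h0 ▸ hzI t), hopt⟩
  · obtain ⟨z₁, hz₁, hz₁I, hle⟩ := h.isSurplusChain.exists_monotone_without_lottery ae_mem_typeLaw
      hc hpos h.income_le (menuSurplus_of_pos hpos h.income_le)
      (menuDeriv_of_pos hpos h.income_le) hz fun t => (hzI t).2
    exact ⟨z₁, hz₁, hz₁I, fun z' hz' hz'I => (hopt z' hz' hz'I).trans hle⟩

/-- Among all incentive compatible mechanisms, welfare plus revenue is maximized by one without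
ordeals, which can be chosen individually rational. -/
lemma exists_optimal_noOrdeal (h : IsOrdealEnvironment tlo thi llo lhi f lam X ψ)
    (hcond : OrdealCostAntitone tlo thi X ψ ∨ SurplusRatioCondition tlo thi llo lhi X ψ)
    {w : ℝ → ℝ} (hw : ContinuousOn w (Icc tlo thi)) (hwanti : AntitoneOn w (Icc tlo thi))
    (hw1 : ∫ t, w t ∂(typeLaw tlo thi f) = 1) :
    ∃ (x : ℝ → ℝ × ℝ) (T : ℝ → ℝ), IsScreeningFeasible tlo thi (typeLaw tlo thi f) X ψ x T ∧
      (∀ t, x t ∈ noOrdealMenu llo lhi) ∧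
      ∀ (x' : ℝ → ℝ × ℝ) (T' : ℝ → ℝ), IsICMechanism tlo thi X ψ x' T' →
        Integrable T' (typeLaw tlo thi f) →
        weightedWelfare (typeLaw tlo thi f) w ψ x' T' + ∫ t, T' t ∂(typeLaw tlo thi f) ≤
          weightedWelfare (typeLaw tlo thi f) w ψ x T + ∫ t, T t ∂(typeLaw tlo thi f) := by
  have := h.isProbabilityMeasure
  have := nullSingletonClass_typeLaw (tlo := tlo) (thi := thi) (f := f)
  have hch := h.isSurplusChain
  have hc : ContinuousOn (fun t => w t - 1) (Icc tlo thi) := hw.sub continuousOn_const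
  have hci : Integrable (fun t => w t - 1) (typeLaw tlo thi f) := hc.integrable_typeLaw
  obtain ⟨z, hz, hzM, hopt⟩ := h.exists_optimal_menu_rule hci
  have hzI : ∀ t, z t ∈ Icc 0 lhi := fun t => by
    rcases hzM t with ht | ht
    · exact ⟨h.income_nonneg.trans ht.1, ht.2⟩
    · rw [ht]; exact ⟨le_rfl, h.income_nonneg.trans h.income_le⟩
  set R := infoRent tlo (menuDeriv tlo thi llo lhi ψ) z with hR
  have hRc : Continuous R := hch.continuous_infoRent hz.measurable
  have hGm : Measurable fun t => menuSurplus tlo thi llo lhi ψ (z t) t :=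
    hch.measurable_surplus hz.measurable measurable_id
  have hG : ∀ s, ∀ t ∈ Icc tlo thi,
      grossPayoff ψ (z s, 0) t = menuSurplus tlo thi llo lhi ψ (z s) t := fun s t ht =>
    (h.menuSurplus_eq (hzM s) ht).symm
  have hic := fun s hs t ht =>
    hch.infoRent_incentive h.type_lt hz hzI (s := s) (t := t) hs ht
  have hGi : Integrable (fun t => menuSurplus tlo thi llo lhi ψ (z t) t) (typeLaw tlo thi f) := by
    obtain ⟨C, hC⟩ := hch.bounded_surplus
    exact (integrable_const C).mono' hGm.aestronglyMeasurable
      (Filter.Eventually.of_forall fun t => hC _ _)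
  -- The tax leaves each type exactly its information rent, so the lowest type gets zero utility.
  have hTi : Integrable (fun t => menuSurplus tlo thi llo lhi ψ (z t) t - R t)
      (typeLaw tlo thi f) := hGi.sub hRc.continuousOn.integrable_typeLaw
  have hmech : IsICMechanism tlo thi X ψ (fun t => (z t, 0))
      fun t => menuSurplus tlo thi llo lhi ψ (z t) t - R t := by
    refine ⟨hz.measurable.prodMk measurable_const, hGm.sub hRc.measurable,
      fun t _ => h.menu_mem (hzM t), fun t ht s hs => ?_⟩
    rw [hG s t ht, hG t t ht]
    linarith [hic s hs t ht]
  refine ⟨_, _, ⟨hmech, fun t ht => ?_, hTi⟩, fun t => ⟨hzM t, rfl⟩, fun x' T' hm' hT' => ?_⟩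
  · have ha : tlo ∈ Icc tlo thi := left_mem_Icc.2 h.type_lt.le
    have h1 := hic tlo ha t ht
    have h2 : R tlo = 0 := intervalIntegral.integral_same
    have h3 := hch.monotone_type (z tlo) tlo ha t ht ht.1
    rw [hG t t ht]
    linarith
  · rw [h.weightedWelfare_add_revenue hw hm' hT', h.weightedWelfare_add_revenue hw hmech hTi]
    -- Mean zero makes the level of utility irrelevant, which is why competitors need not be
    -- individually rational.
    have hc0 : ∫ t, (w t - 1) ∂(typeLaw tlo thi f) = 0 := by
      rw [integral_sub hw.integrable_typeLaw (integrable_const _), hw1]; simp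
    obtain ⟨z', hz', hz'I, hle⟩ := hch.exists_monotone_ge_downward h.type_lt ae_mem_typeLaw
      (fun s t hs hst ht => typeLaw_Ico_ne_zero h.density_continuous h.density_pos hs hst ht)
      hci (fun s hs t ht hst => sub_le_sub_right (hwanti hs ht hst) _) hc0
      (h.integrable_surplus hm' hT') (h.continuousOn_utility hm')
      (fun s hs => by
        obtain ⟨ζ, hζ, h1, h2⟩ := h.exists_menu_replacement hcond (hm'.mem s hs) hs
        refine ⟨ζ, hζ, h1, fun r hr hsr => ?_⟩
        linarith [h2 r hr hsr, hm'.ic r hr s hs])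
    refine hle.trans ((hopt z' hz' hz'I).trans_eq ?_)
    refine congrArg₂ (· + ·) (integral_congr_ae ?_) (integral_congr_ae ?_)
    · filter_upwards [ae_mem_typeLaw] with t ht
      exact (hG t t ht).symm
    · filter_upwards [ae_mem_typeLaw] with t ht
      rw [hG t t ht, sub_sub_cancel]

/-- Without redistributive motive every feasible mechanism is optimal. -/
lemma isOptimalTaxMenu_of_weight_eq_zero (h : IsOrdealEnvironment tlo thi llo lhi f lam X ψ)
    (h0 : ∫ t, lam t ∂(typeLaw tlo thi f) = 0) (E : ℝ) :
    IsOptimalTaxMenu tlo thi (typeLaw tlo thi f) X ψ lam E (noOrdealMenu llo lhi) := by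
  have := h.isProbabilityMeasure
  have hlam : ∀ᵐ t ∂(typeLaw tlo thi f), lam t = 0 := by
    refine (integral_eq_zero_iff_of_nonneg_ae ?_ h.weight_continuous.integrable_typeLaw).1 h0
    filter_upwards [ae_mem_typeLaw] with t ht
    exact h.weight_nonneg t ht
  have hW : ∀ x T, weightedWelfare (typeLaw tlo thi f) lam ψ x T = 0 := fun x T => by
    refine integral_eq_zero_of_ae ?_
    filter_upwards [hlam] with t ht
    simp [ht]
  refine ⟨fun _ => (0, 0), fun _ => E, ⟨⟨measurable_const, measurable_const,
    fun t _ => h.menu_mem (Or.inr rfl), fun t ht s hs => le_rfl⟩, integrable_const _, by simp⟩,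
    fun t _ => ⟨Or.inr rfl, rfl⟩, fun x' T' _ => ?_⟩
  rw [hW, hW]

/-- Dividing by the mean weight `κ` makes a lump-sum tax reduce normalized welfare one for one.
Normalized welfare plus revenue is thus invariant under such taxes, and a mechanism that maximizes
it and meets the budget exactly is optimal. -/
lemma isOptimalTaxMenu (h : IsOrdealEnvironment tlo thi llo lhi f lam X ψ)
    (hcond : OrdealCostAntitone tlo thi X ψ ∨ SurplusRatioCondition tlo thi llo lhi X ψ) (E : ℝ) :
    IsOptimalTaxMenu tlo thi (typeLaw tlo thi f) X ψ lam E (noOrdealMenu llo lhi) := by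
  have := h.isProbabilityMeasure
  set κ := ∫ t, lam t ∂(typeLaw tlo thi f) with hκ
  have hκ0 : 0 ≤ κ := by
    refine integral_nonneg_of_ae ?_
    filter_upwards [ae_mem_typeLaw] with t ht
    exact h.weight_nonneg t ht
  rcases hκ0.eq_or_lt with h0 | hpos
  · exact h.isOptimalTaxMenu_of_weight_eq_zero h0.symm E
  have hw1 : ∫ t, lam t / κ ∂(typeLaw tlo thi f) = 1 := by
    rw [integral_div, ← hκ, div_self hpos.ne']
  have hwc : ContinuousOn (fun t => lam t / κ) (Icc tlo thi) := h.weight_continuous.div_const κ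
  obtain ⟨x, T, hfeas, hM, hopt⟩ := h.exists_optimal_noOrdeal hcond hwc
    (fun s hs t ht hst => div_le_div_of_nonneg_right (h.weight_antitone hs ht hst) hpos.le) hw1
  have hWκ : ∀ x T, weightedWelfare (typeLaw tlo thi f) lam ψ x T =
      κ * weightedWelfare (typeLaw tlo thi f) (fun t => lam t / κ) ψ x T := fun x T => by
    unfold weightedWelfare
    rw [← integral_const_mul]
    refine integral_congr_ae (Filter.Eventually.of_forall fun t => ?_)
    simp only
    field_simp
  -- The lump sum, of either sign, that brings revenue to exactly `E`.
  set δ := E - ∫ t, T t ∂(typeLaw tlo thi f) with hδ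
  have hshift : weightedWelfare (typeLaw tlo thi f) (fun t => lam t / κ) ψ x (fun t => T t + δ) =
      weightedWelfare (typeLaw tlo thi f) (fun t => lam t / κ) ψ x T - δ := by
    have hU := h.continuousOn_utility hfeas.isIC
    have e : δ = ∫ t, lam t / κ * δ ∂(typeLaw tlo thi f) := by
      rw [integral_mul_const, hw1, one_mul]
    unfold weightedWelfare
    conv_rhs => rw [e]
    have h1 : Integrable (fun t => lam t / κ * (grossPayoff ψ (x t) t - T t))
        (typeLaw tlo thi f) := (hwc.mul hU).integrable_typeLaw
    rw [← integral_sub h1 (hwc.integrable_typeLaw.mul_const δ)]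
    exact integral_congr_ae (Filter.Eventually.of_forall fun t => by ring)
  refine ⟨x, fun t => T t + δ, ⟨⟨hfeas.isIC.measurable_alloc,
    hfeas.isIC.measurable_tax.add_const δ, hfeas.isIC.mem, fun t ht s hs => ?_⟩,
    hfeas.integrable_tax.add (integrable_const δ), ?_⟩, fun t _ => hM t, fun x' T' hf' => ?_⟩
  · linarith [hfeas.isIC.ic t ht s hs]
  · rw [integral_add hfeas.integrable_tax (integrable_const δ)]
    simp [hδ]
  · rw [hWκ x' T', hWκ, hshift]
    refine mul_le_mul_of_nonneg_left ?_ hpos.le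
    linarith [hopt x' T' hf'.isIC hf'.integrable_tax, hf'.budget]

lemma isOptimalScreeningMenu (h : IsOrdealEnvironment tlo thi llo lhi f lam X ψ)
    (hcond : OrdealCostAntitone tlo thi X ψ ∨ SurplusRatioCondition tlo thi llo lhi X ψ) {κ : ℝ}
    (hκ : 0 < κ) (hκ1 : ∫ t, lam t / κ ∂(typeLaw tlo thi f) = 1) :
    IsOptimalScreeningMenu tlo thi (typeLaw tlo thi f) X ψ (fun t => lam t / κ)
      (noOrdealMenu llo lhi) := by
  obtain ⟨x, T, hfeas, hM, hopt⟩ := h.exists_optimal_noOrdeal hcond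
    (h.weight_continuous.div_const κ)
    (fun s hs t ht hst => div_le_div_of_nonneg_right (h.weight_antitone hs ht hst) hκ.le) hκ1
  exact ⟨x, T, hfeas, fun t _ => hM t, fun x' T' hf' => hopt x' T' hf'.isIC hf'.integrable_tax⟩

end IsOrdealEnvironment

theorem mainTheorem8 (tlo thi llo lhi : ℝ) (f lam : ℝ → ℝ) (X : Set (ℝ × ℝ))
    (ψ : ℝ → ℝ → ℝ → ℝ)
    (henv : IsOrdealEnvironment tlo thi llo lhi f lam X ψ)
    (hcond : OrdealCostAntitone tlo thi X ψ ∨ SurplusRatioCondition tlo thi llo lhi X ψ) :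
    (∀ G : ℝ, 0 ≤ G →
      IsOptimalTaxMenu tlo thi (typeLaw tlo thi f) X ψ lam G (noOrdealMenu llo lhi)) ∧
    (∀ κ : ℝ, 0 < κ → ∫ t, lam t / κ ∂(typeLaw tlo thi f) = 1 →
      IsOptimalScreeningMenu tlo thi (typeLaw tlo thi f) X ψ (fun t => lam t / κ)
        (noOrdealMenu llo lhi)) :=
  ⟨fun G _ => henv.isOptimalTaxMenu hcond G,
    fun _ hκ hκ1 => henv.isOptimalScreeningMenu hcond hκ hκ1⟩
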